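/- Let $G$ be a Lie group of dimension $n\ge 3$ with Lie algebra $\mathfrak g$, such that every left-invariant Riemannian metric on $G$ has non-positive scalar curvature. Let $I=[t_0,\infty)$ and let $J\subset\mathbb R$ be an interval with non-empty interior. Let $\gamma\in C^2(I)$ be a family of inner products on $\mathfrak g$, $\phi\in C^2(I,J)$, and let $\rho$, $j$, $S$ be $C^1$ families on $I$ of real numbers, of covectors on $\mathfrak g$ and of symmetric bilinear forms on $\mathfrak g$. Identify tensors on $\mathfrak g$ with left-invariant tensors on $G$, let $\pi:G\times I\to G$ be the projection, and on $M=G\times I$ put $$g=\pi^*\gamma-dt\otimes dt,\qquad T=\pi^*S-\pi^*j\otimes dt-dt\otimes\pi^*j+\rho\,dt\otimes dt .$$ Let $C\in C^1(J)$, $c\in C(J)$ and $V\in C^1(J)$, and suppose that on $M$ $$\mathrm{Rc}_g-\tfrac12R_g\,g=\nabla\phi\otimes\nabla\phi-\tfrac12|\nabla\phi|_g^2\,g-V(\phi)\,g+C(\phi)\,T,$$ $$\Box_g\phi-V'(\phi)=-c(\phi)\,\mathrm{tr}_gT,\qquad \mathrm{Div}_g\big(C(\phi)T\big)=c(\phi)\,(\mathrm{tr}_gT)\,\nabla\phi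 .$$ Assume further: * (energy conditions) $|j|_\gamma\le\rho$, $|\mathrm{tr}_\gamma S|\le n\rho$ and $(n-2)\rho+\mathrm{tr}_\gamma S\ge0$ on $I$ (the last one follows from $\rho+\mathrm{tr}_\gamma S\ge 0$, as $\rho\ge 0$ and $n\ge3$); * (couplings) $C\ge0$, and $|c|\le C_0C$ on $J$ for some constant $C_0$; * (potential) $V>0$ on $J$; there is a positive lower semicontinuous function $\bar V$ on the closure of $J$ in $\mathbb R$ with $V\ge\bar V$ on $J$; $V'$ is bounded on every subset of $J$ on which $V$ is bounded; and $V'$ extends to a continuous function with values in $[-\infty,\infty]$ on the closure of $J$ in $[-\infty,\infty]$; * (initial expansion) $H(t_0)>0$, where $H=\frac1{2n}\mathrm{tr}_\gamma\dot\gamma$; * $V_0:=\inf_{t\in I}V(\phi(t))=0$. Then $\phi(t)\to\infty$ or $\phi(t)\to-\infty$ as $t\to\infty$. If $\phi(t)\to\infty$ and the asymptotic steepness satisfies $$\alpha:=\limsup_{x\to\infty}\frac{|V'|}{V}(x)<\frac{2}{\sqrt{n(n-1)}}$$ (that is, $\alpha<\sqrt{2/3}$ when $n=3$), then accelerated expansion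 occurs eventually: for all sufficiently large $t$ one has $H(t)>0$ and the deceleration parameter $q=-1-\dot H/H^2$ satisfies $q(t)<0$. The same holds if $\phi(t)\to-\infty$, with $\limsup_{x\to-\infty}$ in the definition of $\alpha$. -/

import Mathlib

open Filter Topology Set
open scoped Manifold ContDiff

set_option maxSynthPendingDepth 3

noncomputable section

namespace CoupledQuintessence

/-! ### Invariant pseudo-Riemannian geometry

Let `W` be the vector space spanned by a global frame of invariant vector fields that is closed
under the Lie bracket `B`.  Invariant functions depend on one real parameter `t ∈ s` only, and the
frame field `X : W` acts on them by `f ↦ τ X * f'`.  Two cases are used: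

* the Lie group `G`, with `W = 𝔤`, `B` the bracket of `𝔤`, `τ = 0` and nothing depending on `t`;
* the product `M = G × s`, with `W = 𝔤 × ℝ`, where `(x, a)` is the field `x + a ∂ₜ` with `x`
  left-invariant, `B ((x, a), (y, b)) = ([x, y], 0)` and `τ = dt`.

An invariant tensor field is a function of `t` with values in the tensors on `W`.  Derivatives in
`t` are taken within `s`, hence are one-sided at an endpoint of `s`. -/

section Geometry

variable {W : Type*} [NormedAddCommGroup W] [NormedSpace ℝ W]

/-- `g` is a positive definite inner product on `W`. -/
structure IsRiemannian (g : W →L[ℝ] W →L[ℝ] ℝ) : Prop where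
  symm : ∀ x y, g x y = g y x
  pos : ∀ x, x ≠ 0 → 0 < g x x

/-- The trace `g^{ab} A_{ab}` of a bilinear form `A` with respect to a nondegenerate bilinear form
`g`.  Here `g.inverse : W* → W` is the inverse of `g : W → W*`, i.e. it raises an index. -/
def metricTrace (g A : W →L[ℝ] W →L[ℝ] ℝ) : ℝ :=
  LinearMap.trace ℝ W (g.inverse ∘L A).toLinearMap

/-- The squared length `g^{ab} α_a α_b` of a covector `α`. -/
def covectorNormSq (g : W →L[ℝ] W →L[ℝ] ℝ) (α : W →L[ℝ] ℝ) : ℝ :=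
  α (g.inverse α)

/-- The tensor product of two covectors. -/
def covectorMul (α β : W →L[ℝ] ℝ) : W →L[ℝ] W →L[ℝ] ℝ :=
  α.smulRight β

variable (B : W →L[ℝ] W →L[ℝ] W) (τ : W →L[ℝ] ℝ) (s : Set ℝ)
  (g : ℝ → W →L[ℝ] W →L[ℝ] ℝ)

/-- The trilinear form `(X, Y, Z) ↦ X (g (Y, Z))` on frame fields. -/
def dirForm (t : ℝ) : W →L[ℝ] W →L[ℝ] W →L[ℝ] ℝ :=
  τ.smulRight (derivWithin g s t)

/-- The trilinear form `(X, Y, Z) ↦ Z (g (X, Y))` on frame fields. -/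
def dirFormLast (t : ℝ) : W →L[ℝ] W →L[ℝ] W →L[ℝ] ℝ :=
  (ContinuousLinearMap.compL ℝ W ℝ (W →L[ℝ] ℝ)
    ((ContinuousLinearMap.id ℝ ℝ).smulRight τ)) ∘L derivWithin g s t

/-- The trilinear form `(X, Y, Z) ↦ g ([X, Y], Z)` on frame fields. -/
def bracketForm (t : ℝ) : W →L[ℝ] W →L[ℝ] W →L[ℝ] ℝ :=
  (ContinuousLinearMap.compL ℝ W W (W →L[ℝ] ℝ) (g t)) ∘L B

/-- The trilinear form `(X, Y, Z) ↦ g ([X, Z], Y)` on frame fields. -/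
def bracketFormSwap (t : ℝ) : W →L[ℝ] W →L[ℝ] W →L[ℝ] ℝ :=
  (ContinuousLinearMap.flipₗᵢ ℝ W W ℝ).toLinearIsometry.toContinuousLinearMap ∘L
    bracketForm B g t

/-- The Koszul form `g (∇_X Y, Z)`; see `koszul_apply` for the usual formula. -/
def koszul (t : ℝ) : W →L[ℝ] W →L[ℝ] W →L[ℝ] ℝ :=
  (1 / 2 : ℝ) • (dirForm τ s g t + (dirForm τ s g t).flip - dirFormLast τ s g t
    + bracketForm B g t - bracketFormSwap B g t - (bracketFormSwap B g t).flip)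

theorem koszul_apply (t : ℝ) (X Y Z : W) :
    koszul B τ s g t X Y Z = 1 / 2 *
      (τ X * derivWithin g s t Y Z + τ Y * derivWithin g s t X Z - τ Z * derivWithin g s t X Y
        + g t (B X Y) Z - g t (B X Z) Y - g t (B Y Z) X) := by
  simp [koszul, dirForm, dirFormLast, bracketForm, bracketFormSwap]
  ring

/-- The Levi-Civita connection: `leviCivita B τ s g t X Y` is `∇_X Y` at `t`, for frame fields
`X` and `Y`. -/
def leviCivita (t : ℝ) : W →L[ℝ] W →L[ℝ] W :=
  (ContinuousLinearMap.compL ℝ W (W →L[ℝ] ℝ) W (g t).inverse) ∘L koszul B τ s g t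

theorem leviCivita_apply (t : ℝ) (X Y : W) :
    leviCivita B τ s g t X Y = (g t).inverse (koszul B τ s g t X Y) := rfl

/-- The curvature `R(X, Y) Z = ∇_X ∇_Y Z - ∇_Y ∇_X Z - ∇_[X, Y] Z` for frame fields.  As
`∇_Y Z` has `t`-dependent components, `∇_X ∇_Y Z` contains the term `τ X • (∇_Y Z)'`. -/
def riemann (t : ℝ) (X Y Z : W) : W :=
  (leviCivita B τ s g t X (leviCivita B τ s g t Y Z)
      + τ X • derivWithin (leviCivita B τ s g) s t Y Z)
    - (leviCivita B τ s g t Y (leviCivita B τ s g t X Z)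
      + τ Y • derivWithin (leviCivita B τ s g) s t X Z)
    - leviCivita B τ s g t (B X Y) Z

/-- The linear map `X ↦ R(X, Y) Z`. -/
def riemannMap (t : ℝ) (Y Z : W) : W →ₗ[ℝ] W where
  toFun X := riemann B τ s g t X Y Z
  map_add' X X' := by simp [riemann, add_smul]; abel
  map_smul' c X := by simp [riemann, smul_sub, smul_add, mul_smul, smul_comm c (τ Y)]

variable [FiniteDimensional ℝ W]

/-- The Ricci tensor `Rc (Y, Z) = tr (X ↦ R(X, Y) Z)`. -/
def ricci (t : ℝ) : W →L[ℝ] W →L[ℝ] ℝ :=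
  (LinearMap.mk₂ ℝ (fun Y Z => LinearMap.trace ℝ W (riemannMap B τ s g t Y Z))
    (fun Y Y' Z => by
      rw [← map_add]; congr 1; ext X; simp [riemannMap, riemann, add_smul]; abel)
    (fun c Y Z => by
      rw [← map_smul]; congr 1; ext X
      simp [riemannMap, riemann, smul_sub, smul_add, mul_smul, smul_comm c (τ X)])
    (fun Y Z Z' => by
      rw [← map_add]; congr 1; ext X; simp [riemannMap, riemann]; abel)
    (fun c Y Z => by
      rw [← map_smul]; congr 1; ext X
      simp [riemannMap, riemann, smul_sub, smul_add, smul_comm c (τ X),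
        smul_comm c (τ Y)])).toContinuousBilinearMap

theorem ricci_apply (t : ℝ) (Y Z : W) :
    ricci B τ s g t Y Z = LinearMap.trace ℝ W (riemannMap B τ s g t Y Z) := rfl

/-- The scalar curvature. -/
def scalarCurvature (t : ℝ) : ℝ :=
  metricTrace (g t) (ricci B τ s g t)

/-- The differential of an invariant function `f`. -/
def differential (f : ℝ → ℝ) (t : ℝ) : W →L[ℝ] ℝ :=
  derivWithin f s t • τ

/-- The Hessian `(∇² f)(X, Y) = X (Y f) - (∇_X Y) f` of an invariant function. -/
def hessian (f : ℝ → ℝ) (t : ℝ) : W →L[ℝ] W →L[ℝ] ℝ :=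
  derivWithin (derivWithin f s) s t • covectorMul τ τ
    - (ContinuousLinearMap.compL ℝ W W ℝ (differential τ s f t)) ∘L leviCivita B τ s g t

/-- The covariant wave operator `□ f = g^{ab} ∇_a ∇_b f`. -/
def waveOperator (f : ℝ → ℝ) (t : ℝ) : ℝ :=
  metricTrace (g t) (hessian B τ s g f t)

/-- The covariant derivative
`(∇_X A)(Z, Y) = X (A (Z, Y)) - A (∇_X Z, Y) - A (Z, ∇_X Y)` of an invariant covariant
two-tensor field `A`, as a bilinear form in `(X, Z)` for fixed `Y`. -/
def covDeriv (A : ℝ → W →L[ℝ] W →L[ℝ] ℝ) (t : ℝ) (Y : W) : W →L[ℝ] W →L[ℝ] ℝ :=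
  (LinearMap.mk₂ ℝ (fun X Z => τ X * derivWithin A s t Z Y
      - A t (leviCivita B τ s g t X Z) Y - A t Z (leviCivita B τ s g t X Y))
    (fun X X' Z => by simp; ring)
    (fun c X Z => by simp; ring)
    (fun X Z Z' => by simp; ring)
    (fun c X Z => by simp; ring)).toContinuousBilinearMap

/-- The divergence `(Div A)(Y) = g^{ab} (∇_a A)(e_b, Y)`. -/
def divergence (A : ℝ → W →L[ℝ] W →L[ℝ] ℝ) (t : ℝ) (Y : W) : ℝ :=
  metricTrace (g t) (covDeriv B τ s g A t Y)

end Geometry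

/-! ### Left-invariant metrics on a Lie group -/

section Group

variable (E : Type*) [NormedAddCommGroup E] [NormedSpace ℝ E] [FiniteDimensional ℝ E]
  (G : Type*) [TopologicalSpace G] [ChartedSpace E G] [Group G] [LieGroup 𝓘(ℝ, E) ∞ G]

/-- The Lie bracket of the Lie algebra `𝔤 = T_1 G` of `G`, that is, of left-invariant vector
fields.  The vector space `T_1 G` is the model space `E`. -/
def groupBracket : E →L[ℝ] E →L[ℝ] E :=
  haveI : CompleteSpace E := FiniteDimensional.complete ℝ E
  haveI : LieGroup 𝓘(ℝ, E) (minSmoothness ℝ 3) G :=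
    LieGroup.of_le (n := ∞) (by rw [minSmoothness_of_isRCLikeNormedField]; exact ENat.LEInfty.out)
  LinearMap.toContinuousBilinearMap (𝕜 := ℝ) (E := E) (F := E) (G := E)
    (LinearMap.mk₂ ℝ
      (fun x y : E => @Bracket.bracket (GroupLieAlgebra 𝓘(ℝ, E) G) (GroupLieAlgebra 𝓘(ℝ, E) G) _ x y)
      (fun x y z => @add_lie (GroupLieAlgebra 𝓘(ℝ, E) G) (GroupLieAlgebra 𝓘(ℝ, E) G) _ _ _ x y z)
      (fun c x y => @smul_lie ℝ (GroupLieAlgebra 𝓘(ℝ, E) G) (GroupLieAlgebra 𝓘(ℝ, E) G)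
        _ _ _ _ _ _ _ c x y)
      (fun x y z => @lie_add (GroupLieAlgebra 𝓘(ℝ, E) G) (GroupLieAlgebra 𝓘(ℝ, E) G) _ _ _ x y z)
      (fun c x y => @lie_smul ℝ (GroupLieAlgebra 𝓘(ℝ, E) G) (GroupLieAlgebra 𝓘(ℝ, E) G)
        _ _ _ _ _ _ _ c x y))

theorem groupBracket_apply (x y : GroupLieAlgebra 𝓘(ℝ, E) G) :
    groupBracket E G x y = ⁅x, y⁆ := rfl

/-- The scalar curvature `R_γ` of the left-invariant metric on `G` given by `γ` on `𝔤`. -/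
def groupScalarCurvature (γ : E →L[ℝ] E →L[ℝ] ℝ) : ℝ :=
  scalarCurvature (groupBracket E G) 0 univ (fun _ => γ) 0

end Group

/-! ### The space-time `M = G × I` -/

section SpaceTime

variable {E : Type*} [NormedAddCommGroup E] [NormedSpace ℝ E]

/-- The bracket `[(x, a), (y, b)] = ([x, y], 0)` of the fields `x + a ∂ₜ` and `y + b ∂ₜ` on
`G × I`, with `x`, `y` left-invariant and `a`, `b` constant. -/
def productBracket (B : E →L[ℝ] E →L[ℝ] E) : (E × ℝ) →L[ℝ] (E × ℝ) →L[ℝ] (E × ℝ) :=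
  (ContinuousLinearMap.compL ℝ (E × ℝ) E (E × ℝ) (ContinuousLinearMap.inl ℝ E ℝ)) ∘L
    B.bilinearComp (ContinuousLinearMap.fst ℝ E ℝ) (ContinuousLinearMap.fst ℝ E ℝ)

theorem productBracket_apply (B : E →L[ℝ] E →L[ℝ] E) (X Y : E × ℝ) :
    productBracket B X Y = (B X.1 Y.1, 0) := rfl

/-- The covector `dt` on `G × I`. -/
def dt : (E × ℝ) →L[ℝ] ℝ := ContinuousLinearMap.snd ℝ E ℝ

/-- The pullback to `G × I` of a covector on `𝔤`. -/
def pullCovector (α : E →L[ℝ] ℝ) : (E × ℝ) →L[ℝ] ℝ := α ∘L ContinuousLinearMap.fst ℝ E ℝ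

/-- The pullback to `G × I` of a bilinear form on `𝔤`. -/
def pullForm (A : E →L[ℝ] E →L[ℝ] ℝ) : (E × ℝ) →L[ℝ] (E × ℝ) →L[ℝ] ℝ :=
  A.bilinearComp (ContinuousLinearMap.fst ℝ E ℝ) (ContinuousLinearMap.fst ℝ E ℝ)

/-- The Lorentzian metric `g = π^* γ - dt ⊗ dt`. -/
def lorentzMetric (γ : ℝ → E →L[ℝ] E →L[ℝ] ℝ) (t : ℝ) : (E × ℝ) →L[ℝ] (E × ℝ) →L[ℝ] ℝ :=
  pullForm (γ t) - covectorMul dt dt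

/-- The energy-momentum tensor `T = π^* S - π^* j ⊗ dt - dt ⊗ π^* j + ρ dt ⊗ dt` of the ordinary
matter. -/
def energyMomentum (ρ : ℝ → ℝ) (j : ℝ → E →L[ℝ] ℝ) (S : ℝ → E →L[ℝ] E →L[ℝ] ℝ) (t : ℝ) :
    (E × ℝ) →L[ℝ] (E × ℝ) →L[ℝ] ℝ :=
  pullForm (S t) - covectorMul (pullCovector (j t)) dt - covectorMul dt (pullCovector (j t))
    + ρ t • covectorMul dt dt

/-- `H = - tr_γ k / n` with `k = - (1/2) dγ/dt` and `n = dim G`. -/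
def hubble (I : Set ℝ) (γ : ℝ → E →L[ℝ] E →L[ℝ] ℝ) (t : ℝ) : ℝ :=
  -metricTrace (γ t) (-(1 / 2 : ℝ) • derivWithin γ I t) / Module.finrank ℝ E

/-- The deceleration parameter `q = -1 - H' / H ^ 2`. -/
def deceleration (I : Set ℝ) (γ : ℝ → E →L[ℝ] E →L[ℝ] ℝ) (t : ℝ) : ℝ :=
  -1 - derivWithin (hubble I γ) I t / hubble I γ t ^ 2

/-- Accelerated expansion occurs eventually. -/
def EventuallyAccelerating (I : Set ℝ) (γ : ℝ → E →L[ℝ] E →L[ℝ] ℝ) : Prop :=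
  ∀ᶠ t in atTop, 0 < hubble I γ t ∧ deceleration I γ t < 0

variable [FiniteDimensional ℝ E]

/-- The fields `γ, φ, ρ, j, S` form a solution on `M = G × I` of the coupled
Einstein-scalar field-matter equations with coupling functions `C, c` and potential `V` on the
interval `J`.  Here `B` is the bracket of the Lie algebra of `G`, and `V'` is
`derivWithin V J`. -/
structure IsESMSolution (B : E →L[ℝ] E →L[ℝ] E) (I J : Set ℝ) (C c V : ℝ → ℝ)
    (γ : ℝ → E →L[ℝ] E →L[ℝ] ℝ) (φ ρ : ℝ → ℝ) (j : ℝ → E →L[ℝ] ℝ)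
    (S : ℝ → E →L[ℝ] E →L[ℝ] ℝ) : Prop where
  contDiffOn_metric : ContDiffOn ℝ 2 γ I
  contDiffOn_field : ContDiffOn ℝ 2 φ I
  contDiffOn_density : ContDiffOn ℝ 1 ρ I
  contDiffOn_flow : ContDiffOn ℝ 1 j I
  contDiffOn_pressure : ContDiffOn ℝ 1 S I
  isRiemannian : ∀ t ∈ I, IsRiemannian (γ t)
  mapsTo_field : MapsTo φ I J
  pressure_symm : ∀ t ∈ I, ∀ x y, S t x y = S t y x
  /-- `Rc - (1/2) R g = ∇φ ⊗ ∇φ - (1/2) |∇φ|² g - V(φ) g + C(φ) T` -/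
  einstein : ∀ t ∈ I,
    ricci (productBracket B) dt I (lorentzMetric γ) t
        - (1 / 2 * scalarCurvature (productBracket B) dt I (lorentzMetric γ) t) •
          lorentzMetric γ t
      = covectorMul (differential dt I φ t) (differential dt I φ t)
        - (1 / 2 * covectorNormSq (lorentzMetric γ t) (differential dt I φ t)) •
          lorentzMetric γ t
        - V (φ t) • lorentzMetric γ t
        + C (φ t) • energyMomentum ρ j S t
  /-- `□ φ - V'(φ) = - c(φ) tr T` -/
  scalarField : ∀ t ∈ I,
    waveOperator (productBracket B) dt I (lorentzMetric γ) φ t - derivWithin V J (φ t)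
      = -c (φ t) * metricTrace (lorentzMetric γ t) (energyMomentum ρ j S t)
  /-- `Div (C(φ) T) = c(φ) (tr T) ∇φ` -/
  matter : ∀ t ∈ I, ∀ Y : E × ℝ,
    divergence (productBracket B) dt I (lorentzMetric γ)
        (fun r => C (φ r) • energyMomentum ρ j S r) t Y
      = c (φ t) * metricTrace (lorentzMetric γ t) (energyMomentum ρ j S t)
        * differential dt I φ t Y

/-- The dominant and strong energy conditions for the ordinary matter, in the form of the
inequalities `|j|_γ ≤ ρ`, `|tr_γ S| ≤ n ρ` and `(n - 2) ρ + tr_γ S ≥ 0` that they imply.  As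
`ρ ≥ 0`, for `n ≥ 3` the last one also follows from `ρ + tr_γ S ≥ 0`, with which it coincides
if `n = 3`. -/
structure EnergyConditions (I : Set ℝ) (γ : ℝ → E →L[ℝ] E →L[ℝ] ℝ) (ρ : ℝ → ℝ)
    (j : ℝ → E →L[ℝ] ℝ) (S : ℝ → E →L[ℝ] E →L[ℝ] ℝ) : Prop where
  flow_le : ∀ t ∈ I, √(covectorNormSq (γ t) (j t)) ≤ ρ t
  pressure_le : ∀ t ∈ I, |metricTrace (γ t) (S t)| ≤ Module.finrank ℝ E * ρ t
  strong : ∀ t ∈ I, 0 ≤ ((Module.finrank ℝ E : ℝ) - 2) * ρ t + metricTrace (γ t) (S t)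

end SpaceTime

/-! ### Potentials and coupling functions -/

/-- `C ∈ C¹(J)` and `c ∈ C(J)` with `C ≥ 0` and `|c| ≤ C₀ C` for a constant `C₀`. -/
structure AdmissibleCoupling (J : Set ℝ) (C c : ℝ → ℝ) : Prop where
  contDiffOn : ContDiffOn ℝ 1 C J
  continuousOn : ContinuousOn c J
  nonneg : ∀ x ∈ J, 0 ≤ C x
  bound : ∃ C₀ : ℝ, ∀ x ∈ J, |c x| ≤ C₀ * C x

/-- The assumptions on the potential `V` on the interval `J`. -/
structure AdmissiblePotential (J : Set ℝ) (V : ℝ → ℝ) : Prop where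
  contDiffOn : ContDiffOn ℝ 1 V J
  pos : ∀ x ∈ J, 0 < V x
  /-- There is a positive lower semicontinuous minorant on the closure of `J` in `ℝ`. -/
  minorant : ∃ Vbar : ℝ → ℝ, LowerSemicontinuousOn Vbar (closure J) ∧
    (∀ x ∈ closure J, 0 < Vbar x) ∧ ∀ x ∈ J, Vbar x ≤ V x
  /-- `V'` is bounded on any subset of `J` on which `V` is bounded. -/
  deriv_bounded : ∀ A ⊆ J, Bornology.IsBounded (V '' A) →
    Bornology.IsBounded (derivWithin V J '' A)
  /-- `V'` extends to a continuous extended-real function on the closure of `J` in `[-∞, ∞]`. -/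
  deriv_extends : ∃ F : EReal → EReal,
    ContinuousOn F (closure ((fun x : ℝ => (x : EReal)) '' J)) ∧
      ∀ x ∈ J, F (x : EReal) = ((derivWithin V J x : ℝ) : EReal)

/-- The asymptotic steepness `limsup |V'| / V` of `V` on `J`, as an extended real number, along
the filter `l`: `atTop` for `x → ∞` and `atBot` for `x → -∞`. -/
def steepness (J : Set ℝ) (V : ℝ → ℝ) (l : Filter ℝ) : EReal :=
  limsup (fun x => ((|derivWithin V J x| / V x : ℝ) : EReal)) (l ⊓ 𝓟 J)

end CoupledQuintessence

end

open CoupledQuintessence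

namespace CoupledQuintessence

/-! ### Traces with respect to a metric -/

section Trace

variable {E : Type*} [NormedAddCommGroup E] [NormedSpace ℝ E]

/-! Put K = ½ γ⁻¹ dγ/dt, so that H = tr K / n, and write ψ = φ', v = V(φ), N = n(n-1). Expressing
the Ricci tensor of g through γ and K turns the time-time component and the trace of Einstein's
equation into the Hamiltonian constraint and the Raychaudhuri equation. With R_γ ≤ 0, the energy
conditions and (tr K)² ≤ n tr K² these give the inequalities collected in `ReducedDynamics`: ψ² + 2v
≤ N H², N H' ≤ -f with f = (n-1)ψ² + N H² - 2v ≥ 0, and 2v - N H² ≤ (n-1) H'. The scalar field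
equation holds up to an error controlled by N H² - 2v.

Hence H stays positive and is non-increasing. Since f is dominated by the rate of decrease of N H
and f' is bounded above, f tends to 0 (`tendsto_kinetic`). If H stayed away from 0, so would v,
against V₀ = 0; thus H → 0 and v → 0 (`tendsto_hubble`, `tendsto_potential`). The positive minorant
of V then drives φ out of every compact set (`tendsto_field`).

By the last inequality, q < 0 as soon as the density 2v/(N H²) exceeds 1 - 1/n. While the density is
at most 1 - 3/(4n), the steepness bound makes log(v/H²) grow at rate at least H/(2n)
(`log_density_deriv`). As H' ≥ -n H² and H → 0, the integral of H diverges, so this level is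
reached; it is never crossed downwards afterwards, and above it H' ≥ -¾ H², that is, q ≤ -1/4
(`eventually_accelerating`). -/

@[simp] theorem covectorMul_apply (α β : E →L[ℝ] ℝ) (x y : E) :
    covectorMul α β x y = α x * β y := by
  simp [covectorMul]

@[simp] theorem pullForm_apply (A : E →L[ℝ] E →L[ℝ] ℝ) (X Y : E × ℝ) :
    pullForm A X Y = A X.1 Y.1 := rfl

@[simp] theorem pullCovector_apply (α : E →L[ℝ] ℝ) (X : E × ℝ) :
    pullCovector α X = α X.1 := rfl

@[simp] theorem dt_apply (X : E × ℝ) : dt X = X.2 := rfl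

theorem lorentzMetric_apply (γ : ℝ → E →L[ℝ] E →L[ℝ] ℝ) (t : ℝ) (X Y : E × ℝ) :
    lorentzMetric γ t X Y = γ t X.1 Y.1 - X.2 * Y.2 := by
  simp [lorentzMetric]

theorem metricTrace_add (g A A' : E →L[ℝ] E →L[ℝ] ℝ) :
    metricTrace g (A + A') = metricTrace g A + metricTrace g A' := by
  simp [metricTrace, ContinuousLinearMap.comp_add]

theorem metricTrace_smul (g : E →L[ℝ] E →L[ℝ] ℝ) (a : ℝ) (A : E →L[ℝ] E →L[ℝ] ℝ) :
    metricTrace g (a • A) = a * metricTrace g A := by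
  simp [metricTrace]

theorem metricTrace_sub (g A A' : E →L[ℝ] E →L[ℝ] ℝ) :
    metricTrace g (A - A') = metricTrace g A - metricTrace g A' := by
  simp [metricTrace, ContinuousLinearMap.comp_sub]

theorem metricTrace_comp {g : E →L[ℝ] E →L[ℝ] ℝ} (hg : g.IsInvertible) (L : E →L[ℝ] E) :
    metricTrace g (g ∘L L) = LinearMap.trace ℝ E L.toLinearMap := by
  rw [metricTrace, ← ContinuousLinearMap.comp_assoc, hg.inverse_comp_self,
    ContinuousLinearMap.id_comp]

variable [FiniteDimensional ℝ E]

theorem metricTrace_self {g : E →L[ℝ] E →L[ℝ] ℝ} (hg : g.IsInvertible) :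
    metricTrace g g = Module.finrank ℝ E := by
  have := metricTrace_comp hg (ContinuousLinearMap.id ℝ E)
  rwa [ContinuousLinearMap.comp_id, ContinuousLinearMap.coe_id, LinearMap.trace_id] at this

theorem IsRiemannian.isInvertible {g : E →L[ℝ] E →L[ℝ] ℝ} (hg : IsRiemannian g) :
    g.IsInvertible := by
  have hinj : Function.Injective g.toLinearMap := by
    rw [injective_iff_map_eq_zero]
    intro x hx
    by_contra h
    have := hg.pos x h
    have h0 : g x = 0 := hx
    simp [h0] at this
  have hdim : Module.finrank ℝ E = Module.finrank ℝ (E →L[ℝ] ℝ) := by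
    rw [← (LinearMap.toContinuousLinearMap : (E →ₗ[ℝ] ℝ) ≃ₗ[ℝ] (E →L[ℝ] ℝ)).finrank_eq]
    exact (Subspace.dual_finrank_eq (K := ℝ) (V := E)).symm
  exact ⟨(g.toLinearMap.linearEquivOfInjective hinj hdim).toContinuousLinearEquiv, by ext; rfl⟩

/-- A positive semidefinite bilinear form has nonnegative trace. -/
theorem IsRiemannian.metricTrace_nonneg {g A : E →L[ℝ] E →L[ℝ] ℝ} (hg : IsRiemannian g)
    (hA : ∀ x, 0 ≤ A x x) : 0 ≤ metricTrace g A := by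
  -- In a `g`-orthogonal basis the diagonal entries of the endomorphism are A(vᵢ, vᵢ) / g(vᵢ, vᵢ).
  have hsymm : LinearMap.IsSymm (g.toLinearMap₁₂) := ⟨fun x y => by simpa using hg.symm x y⟩
  obtain ⟨v, hv⟩ := LinearMap.BilinForm.exists_orthogonal_basis hsymm
  have hort : ∀ i k, i ≠ k → g (v i) (v k) = 0 := fun i k hik => by simpa using hv hik
  rw [metricTrace, LinearMap.trace_eq_matrix_trace ℝ v, Matrix.trace]
  refine Finset.sum_nonneg fun i _ => ?_
  have hcoef : ∀ x, v.repr x i = g x (v i) / g (v i) (v i) := fun x => by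
    rw [eq_div_iff (hg.pos _ (v.ne_zero i)).ne']
    conv_rhs => rw [← v.sum_repr x]
    rw [map_sum, sum_apply, Finset.sum_eq_single i]
    · simp
    · intro k _ hk
      simp [hort k i hk]
    · simp
  rw [Matrix.diag_apply, LinearMap.toMatrix_apply, hcoef]
  refine div_nonneg ?_ (hg.pos _ (v.ne_zero i)).le
  simpa [hg.isInvertible.self_apply_inverse] using hA (v i)

/-- The Cauchy-Schwarz inequality for the trace of a self-adjoint endomorphism. -/
theorem IsRiemannian.trace_sq_le {g : E →L[ℝ] E →L[ℝ] ℝ} (hg : IsRiemannian g)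
    (L : E →L[ℝ] E) (hL : ∀ x y, g (L x) y = g x (L y)) :
    LinearMap.trace ℝ E L.toLinearMap ^ 2 ≤
      Module.finrank ℝ E * LinearMap.trace ℝ E (L ∘L L).toLinearMap := by
  set n : ℝ := (Module.finrank ℝ E : ℝ) with hn
  set h : ℝ := LinearMap.trace ℝ E L.toLinearMap with hh
  -- M is n times the trace-free part of L. It is self-adjoint, so M² has nonnegative trace, and tr
  -- M² = n (n tr L² - (tr L)²).
  let M : E →L[ℝ] E := n • L - h • ContinuousLinearMap.id ℝ E
  have hM : ∀ x y, g (M x) y = g x (M y) := fun x y => by simp [M, hL]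
  have h1 := hg.metricTrace_nonneg (A := g ∘L (M ∘L M)) fun x => by
    have : (g ∘L (M ∘L M)) x x = g (M x) (M x) := by
      simp only [ContinuousLinearMap.comp_apply]
      exact hM _ _
    rw [this]
    by_cases h0 : M x = 0
    · simp [h0]
    · exact (hg.pos _ h0).le
  rw [metricTrace_comp hg.isInvertible] at h1
  have h2 : (M ∘L M) = (n * n) • (L ∘L L) - (2 * n * h) • L
      + (h * h) • ContinuousLinearMap.id ℝ E := by
    ext x
    simp [M]
    module
  rw [h2] at h1
  simp only [ContinuousLinearMap.toLinearMap_add, ContinuousLinearMap.toLinearMap_sub,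
    ContinuousLinearMap.toLinearMap_smul, map_add, map_sub, map_smul, smul_eq_mul,
    ContinuousLinearMap.coe_id, LinearMap.trace_id, ← hh, ← hn] at h1
  -- Cancelling the factor n requires n > 0; in dimension zero both sides vanish.
  rcases (Nat.cast_nonneg (Module.finrank ℝ E) : (0 : ℝ) ≤ _).eq_or_lt with h0 | h0
  · have hz : Module.finrank ℝ E = 0 := by exact_mod_cast h0.symm
    have : Subsingleton E := Module.finrank_zero_iff.mp hz
    have hL0 : L.toLinearMap = 0 := Subsingleton.elim _ _
    have : h = 0 := by rw [hh, hL0, map_zero]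
    rw [this, hn, ← h0]
    simp
  · rw [← hn] at h0
    have : 0 ≤ n * (n * LinearMap.trace ℝ E (L ∘L L).toLinearMap - h ^ 2) := by linarith
    linarith [nonneg_of_mul_nonneg_right this h0]

/-- The trace of an endomorphism of `E × ℝ` in block form. -/
theorem trace_prod_real (f : E × ℝ →ₗ[ℝ] E × ℝ) :
    LinearMap.trace ℝ (E × ℝ) f =
      LinearMap.trace ℝ E (LinearMap.fst ℝ E ℝ ∘ₗ f ∘ₗ LinearMap.inl ℝ E ℝ) + (f (0, 1)).2 := by
  -- Each summand factors through `E` or `ℝ`, so cyclicity of the trace moves the computation to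
  -- that factor.
  have h1 : f = (f ∘ₗ LinearMap.inl ℝ E ℝ) ∘ₗ LinearMap.fst ℝ E ℝ
      + (f ∘ₗ LinearMap.inr ℝ E ℝ) ∘ₗ LinearMap.snd ℝ E ℝ := by
    ext <;> simp [Prod.mk_zero_zero]
  conv_lhs => rw [h1, map_add, LinearMap.trace_comp_comm', LinearMap.trace_comp_comm'
    (LinearMap.snd ℝ E ℝ)]
  congr 1
  rw [LinearMap.trace_eq_matrix_trace ℝ (Module.Basis.singleton Unit ℝ)]
  simp [Matrix.trace, LinearMap.toMatrix_apply]

end Trace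

/-! ### The product metric: inverse, trace and time derivative -/

section Lorentz

variable {E : Type*} [NormedAddCommGroup E] [NormedSpace ℝ E]

theorem lorentzMetric_inverse {γ : ℝ → E →L[ℝ] E →L[ℝ] ℝ} {t : ℝ}
    (hγ : (γ t).IsInvertible) :
    (lorentzMetric γ t).IsInvertible ∧ ∀ α, (lorentzMetric γ t).inverse α =
      ((γ t).inverse (α ∘L ContinuousLinearMap.inl ℝ E ℝ), -α (0, 1)) := by
  let L : (E × ℝ →L[ℝ] ℝ) →L[ℝ] E × ℝ :=
    ((γ t).inverse ∘L
      (ContinuousLinearMap.compL ℝ E (E × ℝ) ℝ).flip (ContinuousLinearMap.inl ℝ E ℝ)).prod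
    (-ContinuousLinearMap.apply ℝ ℝ ((0, 1) : E × ℝ))
  have hL : ∀ α, L α = ((γ t).inverse (α ∘L ContinuousLinearMap.inl ℝ E ℝ), -α (0, 1)) :=
    fun α => rfl
  have h1 : lorentzMetric γ t ∘L L = ContinuousLinearMap.id ℝ _ := by
    ext α <;> simp [hL, lorentzMetric_apply, hγ.self_apply_inverse, Prod.mk_zero_zero]
  have h2 : L ∘L lorentzMetric γ t = ContinuousLinearMap.id ℝ _ := by
    have h3 : ∀ X : E × ℝ, (lorentzMetric γ t X) ∘L ContinuousLinearMap.inl ℝ E ℝ = γ t X.1 := by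
      intro X
      ext y
      simp [lorentzMetric_apply]
    refine ContinuousLinearMap.ext fun X => ?_
    rw [ContinuousLinearMap.comp_apply, hL, h3, hγ.inverse_apply_self, lorentzMetric_apply]
    simp
  refine ⟨ContinuousLinearMap.IsInvertible.of_inverse h1 h2, fun α => ?_⟩
  rw [ContinuousLinearMap.inverse_eq h1 h2, hL]

theorem metricTrace_lorentz [FiniteDimensional ℝ E] {γ : ℝ → E →L[ℝ] E →L[ℝ] ℝ} {t : ℝ}
    (hγ : (γ t).IsInvertible) (A : E × ℝ →L[ℝ] E × ℝ →L[ℝ] ℝ) :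
    metricTrace (lorentzMetric γ t) A =
      metricTrace (γ t) (A.bilinearComp (ContinuousLinearMap.inl ℝ E ℝ)
        (ContinuousLinearMap.inl ℝ E ℝ)) - A (0, 1) (0, 1) := by
  rw [metricTrace, trace_prod_real, sub_eq_add_neg]
  congr 1
  · rw [metricTrace]
    congr 1
    ext x
    simp only [LinearMap.comp_apply, ContinuousLinearMap.toLinearMap_comp,
      ContinuousLinearMap.coe_coe, (lorentzMetric_inverse hγ).2]
    rfl
  · simp [(lorentzMetric_inverse hγ).2]

/-- The pullback of bilinear forms along `E × ℝ → E` as a continuous linear map. -/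
noncomputable def pullFormL : (E →L[ℝ] E →L[ℝ] ℝ) →L[ℝ] (E × ℝ) →L[ℝ] (E × ℝ) →L[ℝ] ℝ :=
  (ContinuousLinearMap.compL ℝ (E × ℝ) (E →L[ℝ] ℝ) ((E × ℝ) →L[ℝ] ℝ)
    ((ContinuousLinearMap.compL ℝ (E × ℝ) E ℝ).flip (ContinuousLinearMap.fst ℝ E ℝ))) ∘L
  (ContinuousLinearMap.compL ℝ (E × ℝ) E (E →L[ℝ] ℝ)).flip (ContinuousLinearMap.fst ℝ E ℝ)

theorem hasDerivWithinAt_lorentzMetric {γ : ℝ → E →L[ℝ] E →L[ℝ] ℝ} {s : Set ℝ} {t : ℝ}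
    (h : DifferentiableWithinAt ℝ γ s t) :
    HasDerivWithinAt (lorentzMetric γ) (pullForm (derivWithin γ s t)) s t :=
  ((pullFormL (E := E)).hasFDerivAt.comp_hasDerivWithinAt t h.hasDerivWithinAt).sub_const _

theorem derivWithin_lorentzMetric {γ : ℝ → E →L[ℝ] E →L[ℝ] ℝ} {s : Set ℝ} {t : ℝ}
    (h : DifferentiableWithinAt ℝ γ s t) (hs : UniqueDiffWithinAt ℝ s t) :
    derivWithin (lorentzMetric γ) s t = pullForm (derivWithin γ s t) :=
  (hasDerivWithinAt_lorentzMetric h).derivWithin hs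

end Lorentz

/-! ### Connection and curvature of the product metric -/

section Curvature

variable {E : Type*} [NormedAddCommGroup E] [NormedSpace ℝ E]

/-- The shape operator `(1/2) γ⁻¹ dγ/dt` of the slices of constant time. -/
noncomputable def shape (s : Set ℝ) (γ : ℝ → E →L[ℝ] E →L[ℝ] ℝ) (t : ℝ) : E →L[ℝ] E :=
  (γ t).inverse ∘L ((1 / 2 : ℝ) • derivWithin γ s t)

theorem comp_shape {s : Set ℝ} {γ : ℝ → E →L[ℝ] E →L[ℝ] ℝ} {t : ℝ} (hγ : (γ t).IsInvertible) :
    γ t ∘L shape s γ t = (1 / 2 : ℝ) • derivWithin γ s t := by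
  rw [shape, ← ContinuousLinearMap.comp_assoc, hγ.self_comp_inverse, ContinuousLinearMap.id_comp]

theorem apply_shape {s : Set ℝ} {γ : ℝ → E →L[ℝ] E →L[ℝ] ℝ} {t : ℝ} (hγ : (γ t).IsInvertible)
    (x y : E) : γ t (shape s γ t x) y = 1 / 2 * derivWithin γ s t x y := by
  rw [← ContinuousLinearMap.comp_apply, comp_shape hγ]
  simp

/-- This is what makes `shape` self-adjoint with respect to γ. -/
theorem derivWithin_symm {s : Set ℝ} {γ : ℝ → E →L[ℝ] E →L[ℝ] ℝ} {t : ℝ}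
    (hd : DifferentiableWithinAt ℝ γ s t) (hs : UniqueDiffWithinAt ℝ s t) (ht : t ∈ s)
    (hγ : ∀ r ∈ s, ∀ x y, γ r x y = γ r y x) (x y : E) :
    derivWithin γ s t x y = derivWithin γ s t y x := by
  have h : ∀ x y : E, HasDerivWithinAt (fun r => γ r x y) (derivWithin γ s t x y) s t := by
    intro x y
    have h1 := (hd.hasDerivWithinAt.clm_apply (hasDerivWithinAt_const t s x)).clm_apply
      (hasDerivWithinAt_const t s y)
    simpa using h1
  exact hs.eq_deriv _ (h x y) ((h y x).congr (fun r hr => hγ r hr x y) (hγ t ht x y))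

/-- The term `koszul B 0 univ (fun _ => γ t) 0` belongs to the metric frozen at time t: with `τ = 0`
nothing is differentiated, so `univ` and the final `0` are placeholders. -/
theorem koszul_lorentz (B : E →L[ℝ] E →L[ℝ] E) {s : Set ℝ} {γ : ℝ → E →L[ℝ] E →L[ℝ] ℝ} {t : ℝ}
    (hd : DifferentiableWithinAt ℝ γ s t) (hs : UniqueDiffWithinAt ℝ s t) (X Y Z : E × ℝ) :
    koszul (productBracket B) dt s (lorentzMetric γ) t X Y Z =
      koszul B 0 univ (fun _ => γ t) 0 X.1 Y.1 Z.1 + X.2 * (1 / 2 * derivWithin γ s t Y.1 Z.1)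
        + Y.2 * (1 / 2 * derivWithin γ s t X.1 Z.1)
        - Z.2 * (1 / 2 * derivWithin γ s t X.1 Y.1) := by
  simp only [koszul_apply, derivWithin_lorentzMetric hd hs, lorentzMetric_apply,
    productBracket_apply, dt_apply, pullForm_apply, zero_apply]
  ring

/-- Gauss and Weingarten formulas for the slices. The time component carries a plus sign because
raising the index of dt with the Lorentzian metric reverses the sign in the Koszul form. -/
theorem leviCivita_lorentz (B : E →L[ℝ] E →L[ℝ] E) {s : Set ℝ} {γ : ℝ → E →L[ℝ] E →L[ℝ] ℝ}
    {t : ℝ} (hγ : (γ t).IsInvertible) (hd : DifferentiableWithinAt ℝ γ s t)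
    (hs : UniqueDiffWithinAt ℝ s t) (X Y : E × ℝ) :
    leviCivita (productBracket B) dt s (lorentzMetric γ) t X Y =
      (leviCivita B 0 univ (fun _ => γ t) 0 X.1 Y.1 + X.2 • shape s γ t Y.1 + Y.2 • shape s γ t X.1,
        1 / 2 * derivWithin γ s t X.1 Y.1) := by
  rw [leviCivita_apply, (lorentzMetric_inverse hγ).2]
  have h1 : koszul (productBracket B) dt s (lorentzMetric γ) t X Y ∘L
      ContinuousLinearMap.inl ℝ E ℝ = koszul B 0 univ (fun _ => γ t) 0 X.1 Y.1
        + X.2 • ((1 / 2 : ℝ) • derivWithin γ s t Y.1)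
        + Y.2 • ((1 / 2 : ℝ) • derivWithin γ s t X.1) := by
    ext z
    simp [koszul_lorentz B hd hs]
  have h2 : koszul (productBracket B) dt s (lorentzMetric γ) t X Y (0, 1) =
      -(1 / 2 * derivWithin γ s t X.1 Y.1) := by
    rw [koszul_lorentz B hd hs]
    simp
  rw [h1, h2, neg_neg]
  simp [shape, leviCivita_apply]

variable [FiniteDimensional ℝ E]

theorem contDiffOn_inverse {s : Set ℝ} {γ : ℝ → E →L[ℝ] E →L[ℝ] ℝ} {k : ℕ∞ω}
    (hγ : ∀ t ∈ s, (γ t).IsInvertible) (hd : ContDiffOn ℝ k γ s) :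
    ContDiffOn ℝ k (fun t => (γ t).inverse) s := by
  have : CompleteSpace E := FiniteDimensional.complete ℝ E
  intro t ht
  exact ((hγ t ht).contDiffAt_map_inverse).comp_contDiffWithinAt t (hd t ht)

theorem contDiffOn_shape {s : Set ℝ} (hs : UniqueDiffOn ℝ s) {γ : ℝ → E →L[ℝ] E →L[ℝ] ℝ}
    (hγ : ∀ t ∈ s, (γ t).IsInvertible) (hd : ContDiffOn ℝ 2 γ s) :
    ContDiffOn ℝ 1 (shape s γ) s :=
  (contDiffOn_inverse hγ (hd.of_le one_le_two)).clm_comp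
    ((hd.derivWithin hs (by norm_num)).const_smul _)

/-- The curvature contains `derivWithin` of the connection, which is meaningful only once the
connection is known to be differentiable. The connection involves one derivative of γ, hence is C¹
for a C² metric. -/
theorem contDiffOn_leviCivita (B : E →L[ℝ] E →L[ℝ] E) {s : Set ℝ} (hs : UniqueDiffOn ℝ s)
    {γ : ℝ → E →L[ℝ] E →L[ℝ] ℝ} (hγ : ∀ t ∈ s, (γ t).IsInvertible) (hd : ContDiffOn ℝ 2 γ s) :
    ContDiffOn ℝ 1 (leviCivita (productBracket B) dt s (lorentzMetric γ)) s := by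
  have hγ' : ContDiffOn ℝ 1 γ s := hd.of_le one_le_two
  have hdγ : ContDiffOn ℝ 1 (derivWithin γ s) s := hd.derivWithin hs (by norm_num)
  have happ : ∀ {A : ℝ → E →L[ℝ] E →L[ℝ] ℝ}, ContDiffOn ℝ 1 A s → ∀ x y,
      ContDiffOn ℝ 1 (fun t => A t x y) s := fun hA x y =>
    (hA.clm_apply contDiffOn_const).clm_apply contDiffOn_const
  have hsh := contDiffOn_shape hs hγ hd
  rw [contDiffOn_clm_apply]
  intro X
  rw [contDiffOn_clm_apply]
  intro Y
  refine ContDiffOn.congr (f := fun t =>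
    (leviCivita B 0 univ (fun _ => γ t) 0 X.1 Y.1 + X.2 • shape s γ t Y.1 + Y.2 • shape s γ t X.1,
        1 / 2 * derivWithin γ s t X.1 Y.1)) ?_ fun t ht =>
    leviCivita_lorentz B (hγ t ht) (hd.differentiableOn (by norm_num) t ht) (hs t ht) X Y
  refine ContDiffOn.prodMk (ContDiffOn.add (ContDiffOn.add ?_ ?_) ?_) ?_
  · simp only [leviCivita_apply]
    refine (contDiffOn_inverse hγ hγ').clm_apply (contDiffOn_clm_apply.2 fun z => ?_)
    simp only [koszul_apply, zero_apply, zero_mul, add_zero, sub_zero, zero_add]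
    exact contDiffOn_const.mul (((happ hγ' _ _).sub (happ hγ' _ _)).sub (happ hγ' _ _))
  · exact (hsh.clm_apply contDiffOn_const).const_smul _
  · exact (hsh.clm_apply contDiffOn_const).const_smul _
  · exact contDiffOn_const.mul (happ hdγ _ _)

/-- By uniqueness of derivatives, components of the derivative of the connection can be read off
from the explicit formula. -/
theorem hasDerivWithinAt_leviCivita (B : E →L[ℝ] E →L[ℝ] E) {s : Set ℝ} (hs : UniqueDiffOn ℝ s)
    {γ : ℝ → E →L[ℝ] E →L[ℝ] ℝ} (hγ : ∀ t ∈ s, (γ t).IsInvertible) (hd : ContDiffOn ℝ 2 γ s)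
    {t : ℝ} (ht : t ∈ s) (X Y : E × ℝ) :
    HasDerivWithinAt (fun t =>
      (leviCivita B 0 univ (fun _ => γ t) 0 X.1 Y.1 + X.2 • shape s γ t Y.1
        + Y.2 • shape s γ t X.1, 1 / 2 * derivWithin γ s t X.1 Y.1))
      (derivWithin (leviCivita (productBracket B) dt s (lorentzMetric γ)) s t X Y) s t := by
  have h1 := ((contDiffOn_leviCivita B hs hγ hd).differentiableOn (by norm_num) t
    ht).hasDerivWithinAt
  have h2 := (h1.clm_apply (hasDerivWithinAt_const t s X)).clm_apply
    (hasDerivWithinAt_const t s Y)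
  simp only [map_zero, add_zero] at h2
  have heq : ∀ r ∈ s, _ := fun r hr =>
    (leviCivita_lorentz B (hγ r hr) (hd.differentiableOn (by norm_num) r hr) (hs r hr) X Y).symm
  exact h2.congr heq (heq t ht)

/-- The curvature in the time direction. -/
theorem ricci_lorentz_time (B : E →L[ℝ] E →L[ℝ] E) {s : Set ℝ} (hs : UniqueDiffOn ℝ s)
    {γ : ℝ → E →L[ℝ] E →L[ℝ] ℝ} (hγ : ∀ t ∈ s, (γ t).IsInvertible) (hd : ContDiffOn ℝ 2 γ s)
    {t : ℝ} (ht : t ∈ s) :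
    ricci (productBracket B) dt s (lorentzMetric γ) t (0, 1) (0, 1) =
      -LinearMap.trace ℝ E (derivWithin (shape s γ) s t).toLinearMap
        - LinearMap.trace ℝ E (shape s γ t ∘L shape s γ t).toLinearMap := by
  have hLC := leviCivita_lorentz B (hγ t ht) (hd.differentiableOn (by norm_num) t ht) (hs t ht)
  have hDT : ∀ X : E × ℝ, derivWithin (leviCivita (productBracket B) dt s (lorentzMetric γ)) s t
      X (0, 1) = (derivWithin (shape s γ) s t X.1, 0) := by
    intro X
    refine (hs t ht).eq_deriv _ (hasDerivWithinAt_leviCivita B hs hγ hd ht X (0, 1)) ?_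
    have h1 := ((contDiffOn_shape hs hγ hd).differentiableOn (by norm_num) t
      ht).hasDerivWithinAt.clm_apply (hasDerivWithinAt_const t s X.1)
    simp only [map_zero, add_zero] at h1
    simpa using h1.prodMk (hasDerivWithinAt_const t s (0 : ℝ))
  -- Since ∂ₜ is geodesic and commutes with the frame, R(X, ∂ₜ)∂ₜ = -(K' + K²)X, the Riccati
  -- equation for K.
  have hR : ∀ X : E × ℝ, riemann (productBracket B) dt s (lorentzMetric γ) t X (0, 1) (0, 1) =
      (-(derivWithin (shape s γ) s t X.1) - shape s γ t (shape s γ t X.1),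
        0) := by
    intro X
    have h0 : leviCivita (productBracket B) dt s (lorentzMetric γ) t (0, 1) (0, 1) = 0 := by
      simp [hLC]
    have h1 : leviCivita (productBracket B) dt s (lorentzMetric γ) t X (0, 1) =
        (shape s γ t X.1, 0) := by
      simp [hLC]
    have h2 : leviCivita (productBracket B) dt s (lorentzMetric γ) t (0, 1)
        (shape s γ t X.1, 0) = (shape s γ t (shape s γ t X.1), 0) := by
      simp [hLC]
    have h3 : productBracket B X (0, 1) = 0 := by
      simp [productBracket_apply]
    rw [riemann, h0, h1, h2, h3, hDT, hDT]
    ext <;> simp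
    abel
  rw [ricci_apply, trace_prod_real]
  have : LinearMap.fst ℝ E ℝ ∘ₗ riemannMap (productBracket B) dt s (lorentzMetric γ) t (0, 1) (0, 1)
      ∘ₗ LinearMap.inl ℝ E ℝ = -(derivWithin (shape s γ) s t).toLinearMap
        - (shape s γ t ∘L shape s γ t).toLinearMap := by
    ext x
    simp [riemannMap, hR]
  rw [this]
  simp [riemannMap, hR]

/-- The curvature in the space directions. -/
theorem ricci_lorentz_space (B : E →L[ℝ] E →L[ℝ] E) {s : Set ℝ} (hs : UniqueDiffOn ℝ s)
    {γ : ℝ → E →L[ℝ] E →L[ℝ] ℝ} (hγ : ∀ t ∈ s, (γ t).IsInvertible) (hd : ContDiffOn ℝ 2 γ s)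
    {t : ℝ} (ht : t ∈ s) (hγs : ∀ r ∈ s, ∀ x y, γ r x y = γ r y x) :
    (ricci (productBracket B) dt s (lorentzMetric γ) t).bilinearComp
        (ContinuousLinearMap.inl ℝ E ℝ) (ContinuousLinearMap.inl ℝ E ℝ) =
      ricci B 0 univ (fun _ => γ t) 0
        + LinearMap.trace ℝ E (shape s γ t).toLinearMap • (γ t ∘L shape s γ t)
        + γ t ∘L derivWithin (shape s γ) s t := by
  have hd1 := hd.differentiableOn (by norm_num : (2 : ℕ∞ω) ≠ 0)
  have hLC := leviCivita_lorentz B (hγ t ht) (hd1 t ht) (hs t ht)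
  have hadj : ∀ x y, γ t (shape s γ t x) y = γ t (shape s γ t y) x := fun x y => by
    rw [apply_shape (hγ t ht), apply_shape (hγ t ht),
      derivWithin_symm (hd1 t ht) (hs t ht) ht hγs]
  have hK : ∀ x y, 1 / 2 * derivWithin γ s t x y = γ t (shape s γ t x) y := fun x y =>
    (apply_shape (hγ t ht) x y).symm
  simp only [hK] at hLC
  -- Product rule for ½ γ' = γK: the term γ'K equals 2γK², whence the factor 2.
  have hsecond : ∀ y z : E, (derivWithin (leviCivita (productBracket B) dt s (lorentzMetric γ)) s t
      (y, 0) (z, 0)).2 = 2 * γ t (shape s γ t (shape s γ t y)) z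
        + γ t (derivWithin (shape s γ) s t y) z := by
    intro y z
    have h1 := (ContinuousLinearMap.snd ℝ E ℝ).hasFDerivAt.comp_hasDerivWithinAt t
      (hasDerivWithinAt_leviCivita B hs hγ hd ht (y, 0) (z, 0))
    have h2 := ((hd1 t ht).hasDerivWithinAt.clm_apply
      (((contDiffOn_shape hs hγ hd).differentiableOn (by norm_num) t
      ht).hasDerivWithinAt.clm_apply (hasDerivWithinAt_const t s y))).clm_apply
      (hasDerivWithinAt_const t s z)
    have h3 := (hs t ht).eq_deriv _ h1 (h2.congr
      (fun r hr => (apply_shape (hγ r hr) y z).symm) (apply_shape (hγ t ht) y z).symm)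
    simp only [ContinuousLinearMap.coe_snd', map_zero, add_zero, add_apply] at h3
    rw [h3, apply_shape (hγ t ht)]
    ring
  refine ContinuousLinearMap.ext fun y => ContinuousLinearMap.ext fun z => ?_
  change ricci (productBracket B) dt s (lorentzMetric γ) t (y, 0) (z, 0) = _
  rw [ricci_apply, trace_prod_real]
  -- The Gauss equation. On taking the trace, its last term gives -γ(K²y, z), which cancels the K²
  -- term of `htime`.
  have hblock : LinearMap.fst ℝ E ℝ ∘ₗ
      riemannMap (productBracket B) dt s (lorentzMetric γ) t (y, 0) (z, 0)
      ∘ₗ LinearMap.inl ℝ E ℝ = riemannMap B 0 univ (fun _ => γ t) 0 y z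
        + γ t (shape s γ t y) z • (shape s γ t).toLinearMap
        - ((γ t (shape s γ t z)).smulRight (shape s γ t y)).toLinearMap := by
    ext x
    simp [riemannMap, riemann, hLC, productBracket_apply, hadj z x]
    abel
  have htime : (riemannMap (productBracket B) dt s (lorentzMetric γ) t (y, 0) (z, 0) (0, 1)).2
      = γ t (shape s γ t (shape s γ t y)) z + γ t (derivWithin (shape s γ) s t y) z := by
    have h1 : γ t (shape s γ t y) (shape s γ t z) = γ t (shape s γ t (shape s γ t y)) z := by
      rw [hγs t ht, hadj]
    simp [riemannMap, riemann, hLC, productBracket_apply, hsecond, h1]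
    ring
  rw [hblock, htime, map_sub, map_add, map_smul, ← ricci_apply]
  have htr : LinearMap.trace ℝ E ((γ t (shape s γ t z)).smulRight (shape s γ t y)).toLinearMap
      = γ t (shape s γ t (shape s γ t y)) z := by
    rw [← hadj]
    exact LinearMap.trace_smulRight (γ t (shape s γ t z)).toLinearMap _
  rw [htr]
  simp
  ring

end Curvature

/-! ### The field equations in terms of γ and φ -/

section FieldEquations

variable {E : Type*} [NormedAddCommGroup E] [NormedSpace ℝ E]

theorem hubble_eq {s : Set ℝ} {γ : ℝ → E →L[ℝ] E →L[ℝ] ℝ} (t : ℝ) :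
    hubble s γ t = LinearMap.trace ℝ E (shape s γ t).toLinearMap / Module.finrank ℝ E := by
  have h : -metricTrace (γ t) (-(1 / 2 : ℝ) • derivWithin γ s t) =
      metricTrace (γ t) ((1 / 2 : ℝ) • derivWithin γ s t) := by
    rw [metricTrace_smul, metricTrace_smul]
    ring
  rw [hubble, h]
  rfl

variable [FiniteDimensional ℝ E]

theorem hasDerivWithinAt_hubble {s : Set ℝ} (hs : UniqueDiffOn ℝ s)
    {γ : ℝ → E →L[ℝ] E →L[ℝ] ℝ} (hγ : ∀ t ∈ s, (γ t).IsInvertible) (hd : ContDiffOn ℝ 2 γ s)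
    {t : ℝ} (ht : t ∈ s) :
    HasDerivWithinAt (hubble s γ)
      (LinearMap.trace ℝ E (derivWithin (shape s γ) s t).toLinearMap / Module.finrank ℝ E) s t := by
  let L : (E →L[ℝ] E) →L[ℝ] ℝ := LinearMap.toContinuousLinearMap
    (LinearMap.trace ℝ E ∘ₗ ContinuousLinearMap.coeLM (S := ℝ) (R := ℝ))
  have h1 := (L.hasFDerivAt.comp_hasDerivWithinAt t
    ((contDiffOn_shape hs hγ hd).differentiableOn (by norm_num) t ht).hasDerivWithinAt).div_const
    (Module.finrank ℝ E : ℝ)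
  exact h1.congr (fun r _ => hubble_eq r) (hubble_eq t)

/-- The Hamiltonian constraint, the Raychaudhuri equation and the scalar field equation. -/
theorem IsESMSolution.field_equations {B : E →L[ℝ] E →L[ℝ] E} {s J : Set ℝ} (hs : UniqueDiffOn ℝ s)
    {C c V : ℝ → ℝ} {γ : ℝ → E →L[ℝ] E →L[ℝ] ℝ} {φ ρ : ℝ → ℝ} {j : ℝ → E →L[ℝ] ℝ}
    {S : ℝ → E →L[ℝ] E →L[ℝ] ℝ} (h : IsESMSolution B s J C c V γ φ ρ j S)
    {n : ℕ} (hE : Module.finrank ℝ E = n) {t : ℝ} (ht : t ∈ s) :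
    (scalarCurvature B 0 univ (fun _ => γ t) 0
        - LinearMap.trace ℝ E (shape s γ t ∘L shape s γ t).toLinearMap
        + LinearMap.trace ℝ E (shape s γ t).toLinearMap ^ 2
      = derivWithin φ s t ^ 2 + 2 * V (φ t) + 2 * (C (φ t) * ρ t)) ∧
    ((n - 1 : ℝ) * (-LinearMap.trace ℝ E (derivWithin (shape s γ) s t).toLinearMap
        - LinearMap.trace ℝ E (shape s γ t ∘L shape s γ t).toLinearMap)
      = (n - 1) * derivWithin φ s t ^ 2 - 2 * V (φ t)
        + C (φ t) * ((n - 2) * ρ t + metricTrace (γ t) (S t))) ∧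
    derivWithin (derivWithin φ s) s t =
      -LinearMap.trace ℝ E (shape s γ t).toLinearMap * derivWithin φ s t
        - derivWithin V J (φ t) + c (φ t) * (metricTrace (γ t) (S t) - ρ t) := by
  have hγ : ∀ t ∈ s, (γ t).IsInvertible := fun t ht => (h.isRiemannian t ht).isInvertible
  have hd := h.contDiffOn_metric
  have hLC := leviCivita_lorentz B (hγ t ht) (hd.differentiableOn (by norm_num) t ht) (hs t ht)
  have htime := ricci_lorentz_time B hs hγ hd ht
  have hspace := ricci_lorentz_space B hs hγ hd ht (fun r hr => (h.isRiemannian r hr).symm)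
  have hR : scalarCurvature (productBracket B) dt s (lorentzMetric γ) t =
      scalarCurvature B 0 univ (fun _ => γ t) 0
        + LinearMap.trace ℝ E (shape s γ t).toLinearMap ^ 2
        + LinearMap.trace ℝ E (derivWithin (shape s γ) s t).toLinearMap
        - ricci (productBracket B) dt s (lorentzMetric γ) t (0, 1) (0, 1) := by
    rw [scalarCurvature, metricTrace_lorentz (hγ t ht), hspace, metricTrace_add, metricTrace_add,
      metricTrace_smul, metricTrace_comp (hγ t ht), metricTrace_comp (hγ t ht), sq]
    rfl
  have hTrT : metricTrace (lorentzMetric γ t) (energyMomentum ρ j S t) =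
      metricTrace (γ t) (S t) - ρ t := by
    rw [metricTrace_lorentz (hγ t ht)]
    congr 1
    · congr 1
      ext x y
      simp [energyMomentum]
    · simp [energyMomentum]
  have hnorm : covectorNormSq (lorentzMetric γ t) (differential dt s φ t) =
      -derivWithin φ s t ^ 2 := by
    rw [covectorNormSq, (lorentzMetric_inverse (hγ t ht)).2]
    simp [differential]
    ring
  have hTrφ : metricTrace (lorentzMetric γ t)
      (covectorMul (differential dt s φ t) (differential dt s φ t)) = -derivWithin φ s t ^ 2 := by
    rw [metricTrace_lorentz (hγ t ht)]
    have : (covectorMul (differential (dt (E := E)) s φ t) (differential dt s φ t)).bilinearComp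
        (ContinuousLinearMap.inl ℝ E ℝ) (ContinuousLinearMap.inl ℝ E ℝ) = 0 := by
      ext x y
      simp [differential]
    rw [this]
    simp [differential, metricTrace]
    ring
  have hTrg : metricTrace (lorentzMetric γ t) (lorentzMetric γ t) = n + 1 := by
    rw [metricTrace_self (lorentzMetric_inverse (hγ t ht)).1, Module.finrank_prod, hE]
    simp
  -- Two scalar consequences of Einstein's equation suffice: its full trace, and below its (∂ₜ, ∂ₜ)
  -- component.
  have htrace := congrArg (metricTrace (lorentzMetric γ t)) (h.einstein t ht)
  simp only [metricTrace_add, metricTrace_sub, metricTrace_smul, hTrT, hTrφ, hTrg, hnorm]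
    at htrace
  rw [← scalarCurvature] at htrace
  have hT := congrArg (fun A : E × ℝ →L[ℝ] E × ℝ →L[ℝ] ℝ => A (0, 1) (0, 1)) (h.einstein t ht)
  simp only [add_apply, sub_apply, smul_apply, covectorMul_apply, lorentzMetric_apply, hnorm]
    at hT
  simp only [add_apply, sub_apply, smul_apply, covectorMul_apply, differential, dt_apply,
    energyMomentum, smul_eq_mul, pullForm_apply, pullCovector_apply, map_zero] at hT
  have hwave : waveOperator (productBracket B) dt s (lorentzMetric γ) φ t =
      -derivWithin (derivWithin φ s) s t
        - LinearMap.trace ℝ E (shape s γ t).toLinearMap * derivWithin φ s t := by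
    rw [waveOperator, metricTrace_lorentz (hγ t ht)]
    have h1 : (hessian (productBracket B) dt s (lorentzMetric γ) φ t).bilinearComp
        (ContinuousLinearMap.inl ℝ E ℝ) (ContinuousLinearMap.inl ℝ E ℝ) =
          (-derivWithin φ s t) • (γ t ∘L shape s γ t) := by
      ext x y
      simp [hessian, differential, hLC, apply_shape (hγ t ht)]
    have h2 : hessian (productBracket B) dt s (lorentzMetric γ) φ t (0, 1) (0, 1) =
        derivWithin (derivWithin φ s) s t := by
      simp [hessian, differential, hLC]
    rw [h1, h2, metricTrace_smul, metricTrace_comp (hγ t ht)]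
    ring
  have hscalar := h.scalarField t ht
  rw [hwave, hTrT] at hscalar
  rw [htime] at hR hT
  refine ⟨?_, ?_, by linarith⟩
  · linarith
  -- This combination eliminates the scalar curvature and leaves (n-1) Rc(∂ₜ, ∂ₜ).
  · linear_combination ((n : ℝ) - 1) * hT + htrace

end FieldEquations

/-! ### Reduction to differential inequalities for H and φ -/

section Reduction

variable {E : Type*} [NormedAddCommGroup E] [NormedSpace ℝ E] [FiniteDimensional ℝ E]

/-- The differential inequalities for the Hubble parameter and the scalar field that follow from
the field equations and the energy conditions. -/
theorem IsESMSolution.hubble_inequalities {B : E →L[ℝ] E →L[ℝ] E} {s J : Set ℝ}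
    (hs : UniqueDiffOn ℝ s)
    {C c V : ℝ → ℝ} {γ : ℝ → E →L[ℝ] E →L[ℝ] ℝ} {φ ρ : ℝ → ℝ} {j : ℝ → E →L[ℝ] ℝ}
    {S : ℝ → E →L[ℝ] E →L[ℝ] ℝ} (h : IsESMSolution B s J C c V γ φ ρ j S)
    (henergy : EnergyConditions s γ ρ j S) (hC : ∀ x ∈ J, 0 ≤ C x) {C₀ : ℝ}
    (hc : ∀ x ∈ J, |c x| ≤ C₀ * C x)
    {n : ℕ} (hn : 2 ≤ n) (hE : Module.finrank ℝ E = n) {t : ℝ} (ht : t ∈ s)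
    (hR : scalarCurvature B 0 univ (fun _ => γ t) 0 ≤ 0) :
    ∃ H', HasDerivWithinAt (hubble s γ) H' s t ∧
      derivWithin φ s t ^ 2 + 2 * V (φ t) ≤ n * (n - 1) * hubble s γ t ^ 2 ∧
      n * (n - 1) * H' ≤
        -((n - 1) * derivWithin φ s t ^ 2 + n * (n - 1) * hubble s γ t ^ 2 - 2 * V (φ t)) ∧
      2 * V (φ t) - n * (n - 1) * hubble s γ t ^ 2 ≤ (n - 1) * H' ∧
      |derivWithin (derivWithin φ s) s t + n * hubble s γ t * derivWithin φ s t
          + derivWithin V J (φ t)| ≤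
        |C₀| * (n + 1) * (n * (n - 1) * hubble s γ t ^ 2 - 2 * V (φ t)) := by
  have hγ : ∀ t ∈ s, (γ t).IsInvertible := fun t ht => (h.isRiemannian t ht).isInvertible
  have hd := h.contDiffOn_metric
  obtain ⟨e1, e2, e3⟩ := h.field_equations hs hE ht
  have hn2 : (2 : ℝ) ≤ n := by exact_mod_cast hn
  have hn0 : (n : ℝ) ≠ 0 := by positivity
  have hd1 := hd.differentiableOn (by norm_num : (2 : ℕ∞ω) ≠ 0) t ht
  have hsq := (h.isRiemannian t ht).trace_sq_le (shape s γ t) fun x y => by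
    rw [(h.isRiemannian t ht).symm x, apply_shape (hγ t ht), apply_shape (hγ t ht),
      derivWithin_symm hd1 (hs t ht) ht fun r hr => (h.isRiemannian r hr).symm]
  have hH := hubble_eq (s := s) (γ := γ) t
  have hp := henergy.pressure_le t ht
  have hst := henergy.strong t ht
  have hρ : 0 ≤ ρ t := (Real.sqrt_nonneg _).trans (henergy.flow_le t ht)
  have hCt := hC _ (h.mapsTo_field ht)
  have hct := hc _ (h.mapsTo_field ht)
  refine ⟨_, hasDerivWithinAt_hubble hs hγ hd ht, ?_⟩
  rw [hE] at hsq hH hp hst ⊢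
  rw [eq_div_iff hn0] at hH
  generalize hubble s γ t = H at *
  generalize LinearMap.trace ℝ E (shape s γ t).toLinearMap = b at *
  generalize LinearMap.trace ℝ E (shape s γ t ∘L shape s γ t).toLinearMap = a at *
  generalize LinearMap.trace ℝ E (derivWithin (shape s γ) s t).toLinearMap = d at *
  generalize scalarCurvature B 0 univ (fun _ => γ t) 0 = R at *
  generalize metricTrace (γ t) (S t) = q at *
  generalize derivWithin φ s t = ψ at *
  generalize V (φ t) = v at *
  generalize C (φ t) = k at *
  generalize c (φ t) = l at *
  generalize ρ t = r at *
  rw [e3]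
  subst hH
  have hkr : 0 ≤ k * r := mul_nonneg hCt hρ
  -- Here a = tr K² and tr K = nH, so this is `trace_sq_le` divided by n.
  have ha : n * H ^ 2 ≤ a := by
    have : (n : ℝ) * (n * H ^ 2) ≤ n * a := by linarith
    exact le_of_mul_le_mul_left this (by positivity)
  have hks : 0 ≤ k * ((n - 2) * r + q) := mul_nonneg hCt hst
  have hkq : k * q ≤ k * (n * r) := mul_le_mul_of_nonneg_left (le_of_abs_le hp) hCt
  -- The constraint with every term on the right nonnegative. It yields the energy bound, and it
  -- also bounds the matter density k r by n(n-1)H² - 2v in the last inequality.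
  have key : n * (n - 1) * H ^ 2 = ψ ^ 2 + 2 * v + 2 * (k * r) - R + (a - n * H ^ 2) := by
    linarith
  refine ⟨by nlinarith, ?_, ?_, ?_⟩
  · have h1 : (n : ℝ) * (n - 1) * (d / n) = (n - 1) * d := by field_simp
    rw [h1]
    have h2 : ((n : ℝ) - 1) * (n * H ^ 2) ≤ (n - 1) * a :=
      mul_le_mul_of_nonneg_left ha (by linarith)
    linarith
  · have h1 : (n : ℝ) * ((n - 1) * (d / n)) = (n - 1) * d := by field_simp
    have h2 : 0 ≤ ((n : ℝ) - 1) * -R := mul_nonneg (by linarith) (by linarith)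
    -- Subtracting n - 1 times the constraint from the Raychaudhuri equation removes both tr K² and
    -- ψ². What is left over has a sign by R_γ ≤ 0 and tr S ≤ nρ.
    have h3 : (n : ℝ) * (2 * v - n * (n - 1) * H ^ 2) ≤ n * ((n - 1) * (d / n)) := by
      rw [h1]
      linear_combination (-(n : ℝ) + 1) * e1 + e2 + h2 + hkq
    exact le_of_mul_le_mul_left h3 (by positivity)
  · have h1 : -(H * n) * ψ - derivWithin V J (φ t) + l * (q - r) + n * H * ψ
        + derivWithin V J (φ t) = l * (q - r) := by ring
    have h2 : |q - r| ≤ (n + 1) * r := by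
      rw [abs_le] at hp ⊢
      constructor <;> linarith
    rw [h1, abs_mul]
    calc |l| * |q - r| ≤ (|C₀| * k) * ((n + 1) * r) := by
          refine mul_le_mul (hct.trans ?_) h2 (abs_nonneg _) (by positivity)
          exact mul_le_mul_of_nonneg_right (le_abs_self _) hCt
      _ = |C₀| * (n + 1) * (k * r) := by ring
      _ ≤ _ := by
          refine mul_le_mul_of_nonneg_left ?_ (by positivity)
          nlinarith [sq_nonneg ψ]

end Reduction

/-! ### Convergence lemmas on a half-line -/

section Analysis

theorem monotoneOn_Ici_of_hasDerivWithinAt_nonneg {f f' : ℝ → ℝ} {a b : ℝ} (hab : a ≤ b)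
    (hf : ∀ t ∈ Ici a, HasDerivWithinAt f (f' t) (Ici a) t) (hf' : ∀ t ∈ Ici b, 0 ≤ f' t) :
    MonotoneOn f (Ici b) :=
  monotoneOn_of_hasDerivWithinAt_nonneg (convex_Ici b)
    (fun t ht => ((hf t (hab.trans ht)).continuousWithinAt.mono (Ici_subset_Ici.2 hab)))
    (fun t ht => (hf t (hab.trans (interior_subset ht))).mono
      (interior_subset.trans (Ici_subset_Ici.2 hab)))
    (fun t ht => hf' t (interior_subset ht))

/-- A nonnegative function with derivative bounded above tends to zero if it is dominated by the
rate of decrease of a function that is bounded below. -/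
theorem tendsto_zero_of_le_neg_deriv {f f' H H' : ℝ → ℝ} {a M m : ℝ}
    (hf : ∀ t ∈ Ici a, HasDerivWithinAt f (f' t) (Ici a) t) (hf' : ∀ t ∈ Ici a, f' t ≤ M)
    (hf0 : ∀ t ∈ Ici a, 0 ≤ f t) (hH : ∀ t ∈ Ici a, HasDerivWithinAt H (H' t) (Ici a) t)
    (hH' : ∀ t ∈ Ici a, H' t ≤ -f t) (hm : ∀ t ∈ Ici a, m ≤ H t) :
    Tendsto f atTop (𝓝 0) := by
  wlog hM : 0 < M generalizing M
  · exact this (M := 1) (fun t ht => (hf' t ht).trans (by linarith)) one_pos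
  have hanti : AntitoneOn H (Ici a) := by
    have := monotoneOn_Ici_of_hasDerivWithinAt_nonneg le_rfl (fun t ht => (hH t ht).neg)
      (fun t ht => by linarith [hH' t ht, hf0 t ht])
    exact fun x hx y hy hxy => neg_le_neg_iff.1 (this hx hy hxy)
  have hgrow : MonotoneOn (fun t => M * t - f t) (Ici a) := by
    refine monotoneOn_Ici_of_hasDerivWithinAt_nonneg (f' := fun t => M * 1 - f' t) le_rfl
      (fun t ht => ((hasDerivWithinAt_id t _).const_mul M).sub (hf t ht))
      (fun t ht => by linarith [hf' t ht])
  rw [Metric.tendsto_atTop]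
  intro ε hε
  -- A one-sided Barbalat argument. As f' ≤ M, f(t) ≥ ε forces f ≥ ε/2 on [t - η, t], so H drops
  -- there by at least ηε/2. The time T is chosen so late that H(T) is within less than ηε/2 of the
  -- infimum.
  set η := ε / (2 * M) with hη
  have hη0 : 0 < η := by positivity
  have hMη : M * η = ε / 2 := by rw [hη]; field_simp
  have hbdd : BddBelow (H '' Ici a) := ⟨m, by rintro _ ⟨t, ht, rfl⟩; exact hm t ht⟩
  obtain ⟨_, ⟨T, hT, rfl⟩, hTlt⟩ := exists_lt_of_csInf_lt (s := H '' Ici a)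
    (nonempty_Ici.image H) (lt_add_of_pos_right _ (by positivity : 0 < ε / 2 * η))
  refine ⟨T + η, fun t ht => ?_⟩
  have ha' : T ≤ t - η := by linarith
  have haη : a ≤ t - η := hT.out.trans ha'
  have hat : a ≤ t := by linarith
  rw [Real.dist_0_eq_abs, abs_of_nonneg (hf0 t hat)]
  by_contra! hge
  have hfs : ∀ r ∈ Icc (t - η) t, ε / 2 ≤ f r := by
    intro r hr
    have h1 : M * r - f r ≤ M * t - f t := hgrow (mem_Ici.2 (haη.trans hr.1)) hat hr.2
    have h2 : M * (t - r) ≤ M * η := mul_le_mul_of_nonneg_left (by linarith [hr.1]) hM.le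
    linarith
  have hdrop : AntitoneOn (fun r => H r + ε / 2 * r) (Icc (t - η) t) := by
    have hsub : Icc (t - η) t ⊆ Ici a := fun r hr => haη.trans hr.1
    refine antitoneOn_of_hasDerivWithinAt_nonpos (f' := fun r => H' r + ε / 2 * 1) (convex_Icc _ _)
      (fun r hr => ?_) (fun r hr => ?_) (fun r hr => ?_)
    · exact (((hH r (hsub hr)).add ((hasDerivWithinAt_id r _).const_mul
        (ε / 2))).continuousWithinAt).mono hsub
    · exact ((hH r (hsub (interior_subset hr))).add ((hasDerivWithinAt_id r _).const_mul
        (ε / 2))).mono (interior_subset.trans hsub)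
    · linarith [hH' r (hsub (interior_subset hr)), hfs r (interior_subset hr)]
  have h1 : H t + ε / 2 * t ≤ H (t - η) + ε / 2 * (t - η) :=
    hdrop (left_mem_Icc.2 (by linarith)) (right_mem_Icc.2 (by linarith)) (by linarith)
  have h2 : H (t - η) ≤ H T := hanti hT haη ha'
  have h3 : sInf (H '' Ici a) ≤ H t := csInf_le hbdd (mem_image_of_mem H hat)
  linarith

/-- A continuous function whose absolute value tends to infinity tends to `∞` or to `-∞`. -/
theorem tendsto_atTop_or_atBot_of_abs {f : ℝ → ℝ} {a : ℝ} (hf : ContinuousOn f (Ici a))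
    (h : Tendsto (fun t => |f t|) atTop atTop) :
    Tendsto f atTop atTop ∨ Tendsto f atTop atBot := by
  obtain ⟨T, hT⟩ := eventually_atTop.1 ((h.eventually_gt_atTop 0).and (eventually_ge_atTop a))
  have hne : ∀ t ∈ Ici T, f t ≠ 0 := fun t ht => abs_pos.1 (hT t ht).1
  have hfT : ContinuousOn f (Ici T) := hf.mono fun t ht => (hT t ht).2
  have hsign : (∀ t ∈ Ici T, 0 < f t) ∨ ∀ t ∈ Ici T, f t < 0 := by
    by_contra! hcon
    obtain ⟨⟨x, hx, hx0⟩, y, hy, hy0⟩ := hcon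
    obtain ⟨z, hz, hz0⟩ := isPreconnected_Ici.intermediate_value hx hy hfT ⟨hx0, hy0⟩
    exact hne z hz hz0
  rcases hsign with hs | hs
  · left
    refine h.congr' ?_
    filter_upwards [eventually_ge_atTop T] with t ht using abs_of_pos (hs t ht)
  · right
    rw [← tendsto_neg_atTop_iff]
    refine h.congr' ?_
    filter_upwards [eventually_ge_atTop T] with t ht using abs_of_neg (hs t ht)

/-- On the compact set closure J ∩ [-R, R] the lower semicontinuous minorant attains a positive
minimum, so φ must leave [-R, R] once V(φ) is below it. Working on the closure covers the case that
φ approaches a finite endpoint missing from J. -/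
theorem AdmissiblePotential.tendsto_field {J : Set ℝ} {V : ℝ → ℝ} (hV : AdmissiblePotential J V)
    {φ : ℝ → ℝ} {a : ℝ} (hφ : ContinuousOn φ (Ici a)) (hJ : MapsTo φ (Ici a) J)
    (h : Tendsto (fun t => V (φ t)) atTop (𝓝 0)) :
    Tendsto φ atTop atTop ∨ Tendsto φ atTop atBot := by
  refine tendsto_atTop_or_atBot_of_abs hφ (tendsto_atTop.2 fun R => ?_)
  obtain ⟨Vbar, hlsc, hpos, hle⟩ := hV.minorant
  have hK : IsCompact (closure J ∩ Icc (-R) R) := isCompact_Icc.inter_left isClosed_closure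
  rcases (closure J ∩ Icc (-R) R).eq_empty_or_nonempty with hempty | hne
  · filter_upwards [eventually_ge_atTop a] with t ht
    by_contra! hlt
    have : φ t ∈ closure J ∩ Icc (-R) R := ⟨subset_closure (hJ ht), abs_le.1 hlt.le⟩
    rw [hempty] at this
    exact this
  · obtain ⟨x, hx, hmin⟩ := (hlsc.mono inter_subset_left).exists_isMinOn hne hK
    filter_upwards [eventually_ge_atTop a, h.eventually_lt_const (hpos x hx.1)] with t ht hlt
    by_contra! hlt'
    have h1 : Vbar x ≤ Vbar (φ t) := hmin ⟨subset_closure (hJ ht), abs_le.1 hlt'.le⟩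
    linarith [hle _ (hJ ht)]

end Analysis

/-! ### Asymptotics of the reduced dynamics -/

section Asymptotics

/-- The reduced dynamics on `[a, ∞)`: `H` is the Hubble parameter, `ψ` the velocity of the scalar
field, `v` the potential and `w` its derivative along the solution. -/
structure ReducedDynamics (n : ℕ) (a A : ℝ) (H H' ψ ψ' v w : ℝ → ℝ) : Prop where
  hubble : ∀ t ∈ Ici a, HasDerivWithinAt H (H' t) (Ici a) t
  velocity : ∀ t ∈ Ici a, HasDerivWithinAt ψ (ψ' t) (Ici a) t
  potential : ∀ t ∈ Ici a, HasDerivWithinAt v (w t * ψ t) (Ici a) t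
  pos : ∀ t ∈ Ici a, 0 < v t
  energy : ∀ t ∈ Ici a, ψ t ^ 2 + 2 * v t ≤ n * (n - 1) * H t ^ 2
  hubble_le : ∀ t ∈ Ici a,
    n * (n - 1) * H' t ≤ -((n - 1) * ψ t ^ 2 + n * (n - 1) * H t ^ 2 - 2 * v t)
  le_hubble : ∀ t ∈ Ici a, 2 * v t - n * (n - 1) * H t ^ 2 ≤ (n - 1) * H' t
  field : ∀ t ∈ Ici a,
    |ψ' t + n * H t * ψ t + w t| ≤ A * (n * (n - 1) * H t ^ 2 - 2 * v t)
  initial : 0 < H a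

namespace ReducedDynamics

variable {n : ℕ} {a A : ℝ} {H H' ψ ψ' v w : ℝ → ℝ}

/-- A zero of H would contradict the energy inequality, because v > 0. -/
theorem hubble_pos (h : ReducedDynamics n a A H H' ψ ψ' v w) {t : ℝ} (ht : t ∈ Ici a) :
    0 < H t := by
  by_contra! hcon
  have hcont : ContinuousOn H (Ici a) := fun t ht => (h.hubble t ht).continuousWithinAt
  obtain ⟨z, hz, hz0⟩ := isPreconnected_Ici.intermediate_value ht self_mem_Ici hcont
    ⟨hcon, h.initial.le⟩
  have h1 := h.energy z hz
  have h2 := h.pos z hz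
  rw [hz0] at h1
  nlinarith [sq_nonneg (ψ z)]

theorem hubble_deriv_nonpos (h : ReducedDynamics n a A H H' ψ ψ' v w) (hn : 2 ≤ n) {t : ℝ}
    (ht : t ∈ Ici a) : H' t ≤ 0 := by
  have hn2 : (2 : ℝ) ≤ n := by exact_mod_cast hn
  have hN : (0 : ℝ) < n * (n - 1) := by nlinarith
  have h1 := h.hubble_le t ht
  have h2 := h.energy t ht
  have h3 : (n : ℝ) * (n - 1) * H' t ≤ 0 := by nlinarith [sq_nonneg (ψ t)]
  exact nonpos_of_mul_nonpos_right h3 hN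

theorem antitoneOn_hubble (h : ReducedDynamics n a A H H' ψ ψ' v w) (hn : 2 ≤ n) :
    AntitoneOn H (Ici a) := by
  have := monotoneOn_Ici_of_hasDerivWithinAt_nonneg le_rfl (fun t ht => (h.hubble t ht).neg)
    (fun t ht => neg_nonneg.2 (h.hubble_deriv_nonpos hn ht))
  exact fun x hx y hy hxy => neg_le_neg_iff.1 (this hx hy hxy)

theorem hubble_sq_le (h : ReducedDynamics n a A H H' ψ ψ' v w) (hn : 2 ≤ n) {t : ℝ}
    (ht : t ∈ Ici a) : n * (n - 1) * H t ^ 2 ≤ n * (n - 1) * H a ^ 2 := by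
  have hn2 : (2 : ℝ) ≤ n := by exact_mod_cast hn
  exact mul_le_mul_of_nonneg_left
    (pow_le_pow_left₀ (h.hubble_pos ht).le (h.antitoneOn_hubble hn self_mem_Ici ht ht) 2)
    (by nlinarith)

/-- The quantity f is nonnegative and at most -n(n-1)H', and H is bounded below by 0, so
`tendsto_zero_of_le_neg_deriv` applies once f' is bounded above. In f' the terms from friction and
from H H' have a favourable sign; the others are bounded by P, W and A. -/
theorem tendsto_kinetic (h : ReducedDynamics n a A H H' ψ ψ' v w) (hn : 2 ≤ n) (hA : 0 ≤ A)
    {W : ℝ} (hW : ∀ t ∈ Ici a, |w t| ≤ W) :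
    Tendsto (fun t => (n - 1) * ψ t ^ 2 + n * (n - 1) * H t ^ 2 - 2 * v t) atTop (𝓝 0) := by
  have hn2 : (2 : ℝ) ≤ n := by exact_mod_cast hn
  set P := n * (n - 1) * H a ^ 2 with hP
  have hP0 : 0 ≤ P := mul_nonneg (by nlinarith) (sq_nonneg _)
  refine tendsto_zero_of_le_neg_deriv (a := a) (m := 0)
    (M := 2 * (n - 1) * ((1 + P) * (W + A * P)) + 2 * (W * (1 + P)))
    (f' := fun t => (n - 1) * (2 * ψ t ^ 1 * ψ' t) + n * (n - 1) * (2 * H t ^ 1 * H' t)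
      - 2 * (w t * ψ t)) (H := fun t => n * (n - 1) * H t) (H' := fun t => n * (n - 1) * H' t)
    (fun t ht => ?_) (fun t ht => ?_) (fun t ht => ?_)
    (fun t ht => (h.hubble t ht).const_mul _) h.hubble_le
    (fun t ht => mul_nonneg (by nlinarith) (h.hubble_pos ht).le)
  · exact ((((h.velocity t ht).pow 2).const_mul _).add (((h.hubble t ht).pow 2).const_mul _)).sub
      ((h.potential t ht).const_mul 2)
  · have hH := h.hubble_pos ht
    have hH' := h.hubble_deriv_nonpos hn ht
    have hHH : 0 ≤ H t * -H' t := mul_nonneg hH.le (by linarith)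
    have hPt : n * (n - 1) * H t ^ 2 ≤ P := h.hubble_sq_le hn ht
    have hψ2 : ψ t ^ 2 ≤ P := by linarith [h.energy t ht, h.pos t ht]
    -- The bound 1 + P avoids a square root: x ≤ 1 + x² for all real x.
    have hψ : |ψ t| ≤ 1 + P := by
      rw [← sq_abs] at hψ2
      nlinarith [sq_nonneg (|ψ t| - 1 / 2)]
    have hW0 : 0 ≤ W := (abs_nonneg _).trans (hW t ht)
    have he : |ψ' t + n * H t * ψ t + w t| ≤ A * P :=
      (h.field t ht).trans (mul_le_mul_of_nonneg_left (by linarith [h.pos t ht]) hA)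
    have h1 : ψ t * (ψ' t + n * H t * ψ t + w t - w t) ≤ (1 + P) * (W + A * P) := by
      refine (le_abs_self _).trans ?_
      rw [abs_mul]
      refine mul_le_mul hψ ?_ (abs_nonneg _) (by linarith)
      linarith [abs_sub (ψ' t + n * H t * ψ t + w t) (w t), hW t ht]
    have h2 : -(w t * ψ t) ≤ W * (1 + P) := by
      refine (neg_le_abs _).trans ?_
      rw [abs_mul]
      exact mul_le_mul (hW t ht) hψ (abs_nonneg _) hW0
    have h3 : 0 ≤ n * H t * ψ t ^ 2 := by positivity
    have h4 : ψ t * ψ' t ≤ (1 + P) * (W + A * P) := by linarith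
    have h5 : ((n : ℝ) - 1) * (ψ t * ψ' t) ≤ (n - 1) * ((1 + P) * (W + A * P)) :=
      mul_le_mul_of_nonneg_left h4 (by linarith)
    have h6 : 0 ≤ (n : ℝ) * (n - 1) * (H t * -H' t) := mul_nonneg (by nlinarith) hHH
    simp only [pow_one]
    linarith
  · nlinarith [h.energy t ht, sq_nonneg (ψ t)]

/-- The expansion dies out if the potential has infimum zero along the solution. -/
theorem tendsto_hubble (h : ReducedDynamics n a A H H' ψ ψ' v w) (hn : 2 ≤ n) (hA : 0 ≤ A)
    {W : ℝ} (hW : ∀ t ∈ Ici a, |w t| ≤ W) (hinf : sInf (v '' Ici a) = 0) :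
    Tendsto H atTop (𝓝 0) := by
  have hn2 : (2 : ℝ) ≤ n := by exact_mod_cast hn
  have hN : (0 : ℝ) < n * (n - 1) := by nlinarith
  have hsmall : ∀ ε > 0, ∃ t ∈ Ici a, H t < ε := by
    by_contra! hcon
    obtain ⟨ε, hε, hHε⟩ := hcon
    -- With H ≥ ε, eventually 2v > n(n-1)ε² - 2m = 2m. On the remaining compact time interval v has
    -- a positive minimum, so its infimum cannot be 0.
    set m := n * (n - 1) * ε ^ 2 / 4 with hm
    have hm0 : 0 < m := by positivity
    obtain ⟨T, hT⟩ := eventually_atTop.1 (((h.tendsto_kinetic hn hA hW).eventually_lt_const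
      (by positivity : 0 < 2 * m)).and (eventually_ge_atTop a))
    have hvT : ∀ t ∈ Ici T, m ≤ v t := by
      intro t ht
      obtain ⟨h1, h2⟩ := hT t ht
      have h3 : n * (n - 1) * ε ^ 2 ≤ n * (n - 1) * H t ^ 2 :=
        mul_le_mul_of_nonneg_left (pow_le_pow_left₀ hε.le (hHε t h2) 2) hN.le
      have h4 : 0 ≤ ((n : ℝ) - 1) * ψ t ^ 2 := mul_nonneg (by linarith) (sq_nonneg _)
      linarith
    have haT : a ≤ T := (hT T le_rfl).2
    have hcont : ContinuousOn v (Icc a T) := fun t ht =>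
      (h.potential t ht.1).continuousWithinAt.mono Icc_subset_Ici_self
    obtain ⟨x, hx, hmin⟩ := isCompact_Icc.exists_isMinOn (nonempty_Icc.2 haT) hcont
    have hlow : min m (v x) ≤ sInf (v '' Ici a) := by
      refine le_csInf (nonempty_Ici.image v) ?_
      rintro _ ⟨t, ht, rfl⟩
      rcases le_total t T with htT | htT
      · exact (min_le_right _ _).trans (hmin ⟨ht, htT⟩)
      · exact (min_le_left _ _).trans (hvT t htT)
    have := lt_min hm0 (h.pos x hx.1)
    linarith
  rw [Metric.tendsto_atTop]
  intro ε hε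
  obtain ⟨T, hT, hTε⟩ := hsmall ε hε
  refine ⟨T, fun t ht => ?_⟩
  have hta : t ∈ Ici a := hT.out.trans ht
  rw [Real.dist_0_eq_abs, abs_of_pos (h.hubble_pos hta)]
  exact (h.antitoneOn_hubble hn hT hta ht).trans_lt hTε

theorem tendsto_potential (h : ReducedDynamics n a A H H' ψ ψ' v w)
    (hH : Tendsto H atTop (𝓝 0)) : Tendsto v atTop (𝓝 0) := by
  have h1 : Tendsto (fun t => n * (n - 1) * H t ^ 2) atTop (𝓝 0) := by
    simpa using (hH.pow 2).const_mul ((n : ℝ) * (n - 1))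
  refine squeeze_zero' ?_ ?_ h1
  · filter_upwards [eventually_ge_atTop a] with t ht using (h.pos t ht).le
  · filter_upwards [eventually_ge_atTop a] with t ht
    nlinarith [h.energy t ht, h.pos t ht, sq_nonneg (ψ t)]

/-- The density parameter of the potential grows as long as it is not close to one. -/
theorem log_density_deriv (h : ReducedDynamics n a A H H' ψ ψ' v w) (hn : 2 ≤ n) {t : ℝ}
    (ht : t ∈ Ici a) (hw : |w t| ≤ 2 / √(n * (n - 1)) * v t)
    (hv : 2 * v t ≤ (1 - 3 / (4 * n)) * (n * (n - 1)) * H t ^ 2) :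
    H t / (2 * n) ≤ w t * ψ t / v t - 2 * (H' t / H t) := by
  have hn2 : (2 : ℝ) ≤ n := by exact_mod_cast hn
  have hn0 : (0 : ℝ) < n := by linarith
  have hN : (0 : ℝ) < n * (n - 1) := by nlinarith
  have hH := h.hubble_pos ht
  have hvt := h.pos t ht
  set r := √((n : ℝ) * (n - 1)) with hr
  have hr0 : 0 < r := Real.sqrt_pos.2 hN
  have hr2 : r ^ 2 = n * (n - 1) := Real.sq_sqrt hN.le
  have h1 : -(2 / r * |ψ t|) ≤ w t * ψ t / v t := by
    rw [le_div_iff₀ hvt]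
    have h2 : |w t * ψ t| ≤ 2 / r * v t * |ψ t| := by
      rw [abs_mul]
      exact mul_le_mul_of_nonneg_right hw (abs_nonneg _)
    linarith [neg_abs_le (w t * ψ t)]
  have h3 : H t / (2 * n) + 2 * (H' t / H t) ≤ -(2 / r * |ψ t|) := by
    have h4 := h.hubble_le t ht
    rw [← hr2] at h4 hv
    -- After multiplication by r²H, the growth rate is at least 2(n-1)ψ² - 2rH|ψ| + (3/2) r²H²/n. A
    -- share r²H²/n makes the quadratic form nonnegative for n ≥ 2; the remaining r²H²/(2n) is the
    -- rate H/(2n).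
    have h5 : 0 ≤ 2 * (n - 1) * |ψ t| ^ 2 - 2 * (r * H t * |ψ t|) + r ^ 2 * H t ^ 2 / n := by
      have h6 : 0 ≤ (n * |ψ t| - r * H t) ^ 2 + (n * (n - 2)) * |ψ t| ^ 2 :=
        add_nonneg (sq_nonneg _) (mul_nonneg (mul_nonneg hn0.le (by linarith)) (sq_nonneg _))
      have h7 : 2 * (n - 1) * |ψ t| ^ 2 - 2 * (r * H t * |ψ t|) + r ^ 2 * H t ^ 2 / n =
          ((n * |ψ t| - r * H t) ^ 2 + (n * (n - 2)) * |ψ t| ^ 2) / n := by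
        field_simp
        ring
      rw [h7]
      exact div_nonneg h6 hn0.le
    rw [sq_abs] at h5
    have h8 : (1 - 3 / (4 * (n : ℝ))) * r ^ 2 * H t ^ 2 =
        r ^ 2 * H t ^ 2 - 3 / 4 * (r ^ 2 * H t ^ 2 / n) := by
      field_simp
    have h9 : (H t / (2 * n) + 2 * (H' t / H t) + 2 / r * |ψ t|) * (r ^ 2 * H t) ≤ 0 := by
      have : (H t / (2 * n) + 2 * (H' t / H t) + 2 / r * |ψ t|) * (r ^ 2 * H t) =
          1 / 2 * (r ^ 2 * H t ^ 2 / n) + 2 * (r ^ 2 * H' t) + 2 * (r * H t * |ψ t|) := by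
        field_simp
      rw [this]
      linarith
    linarith [nonpos_of_mul_nonpos_left h9 (by positivity)]
  linarith

/-- If the potential is eventually not steeper than `2 / √(n (n - 1))`, then the expansion
is eventually accelerated. -/
theorem eventually_accelerating (h : ReducedDynamics n a A H H' ψ ψ' v w) (hn : 2 ≤ n)
    (hH : Tendsto H atTop (𝓝 0)) (hw : ∀ᶠ t in atTop, |w t| ≤ 2 / √(n * (n - 1)) * v t) :
    ∀ᶠ t in atTop, -(3 / 4) * H t ^ 2 ≤ H' t := by
  have hn2 : (2 : ℝ) ≤ n := by exact_mod_cast hn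
  have hn0 : (0 : ℝ) < n := by linarith
  have hN : (0 : ℝ) < n * (n - 1) := by nlinarith
  have hy : (0 : ℝ) < 1 - 3 / (4 * n) := by
    rw [sub_pos, div_lt_one (by positivity)]
    linarith
  obtain ⟨T, hT⟩ := eventually_atTop.1 (hw.and (eventually_ge_atTop a))
  have haT : a ≤ T := (hT T le_rfl).2
  -- The level of log(v/H²) at which the density 2v/(n(n-1)H²) equals 1 - 3/(4n). This exceeds 1 -
  -- 1/n, the threshold for acceleration, so the final bound has a margin.
  set κ : ℝ := Real.log ((1 - 3 / (4 * n)) * (n * (n - 1)) / 2) with hκ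
  set g : ℝ → ℝ := fun t => Real.log (v t) - 2 * Real.log (H t) with hg
  have hgκ : ∀ t ∈ Ici a, (g t ≤ κ ↔ 2 * v t ≤ (1 - 3 / (4 * n)) * (n * (n - 1)) * H t ^ 2) ∧
      (κ ≤ g t ↔ (1 - 3 / (4 * n)) * (n * (n - 1)) * H t ^ 2 ≤ 2 * v t) := by
    intro t ht
    have h1 := h.pos t ht
    have h2 := h.hubble_pos ht
    have h3 : g t = Real.log (v t / H t ^ 2) := by
      rw [hg, Real.log_div h1.ne' (by positivity), Real.log_pow]
      norm_num
    rw [h3, hκ, Real.log_le_log_iff (by positivity) (by positivity),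
      Real.log_le_log_iff (by positivity) (by positivity), div_le_iff₀ (by positivity),
      le_div_iff₀ (by positivity)]
    constructor <;> constructor <;> intro h4 <;> linarith
  have hgd : ∀ t ∈ Ici a,
      HasDerivWithinAt g (w t * ψ t / v t - 2 * (H' t / H t)) (Ici a) t := fun t ht =>
    ((h.potential t ht).log (h.pos t ht).ne').sub
      (((h.hubble t ht).log (h.hubble_pos ht).ne').const_mul 2)
  have hgrow : ∀ t ∈ Ici T, g t ≤ κ → H t / (2 * n) ≤ w t * ψ t / v t - 2 * (H' t / H t) :=
    fun t ht hgt => h.log_density_deriv hn (hT t ht).2 (hT t ht).1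
      ((hgκ t (hT t ht).2).1.1 hgt)
  have hreach : ∃ t ∈ Ici T, κ ≤ g t := by
    by_contra! hcon
    -- Below the level, g' ≥ H/(2n), while H'/H ≥ -nH; the weight 1/(2n²) balances the two. Since
    -- log H → -∞, monotonicity would push g to +∞, contradicting g < κ.
    have hmono : MonotoneOn (fun t => g t + 1 / (2 * n ^ 2) * Real.log (H t)) (Ici T) := by
      refine monotoneOn_Ici_of_hasDerivWithinAt_nonneg haT (fun t ht => (hgd t ht).add
        (((h.hubble t ht).log (h.hubble_pos ht).ne').const_mul (1 / (2 * (n : ℝ) ^ 2))))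
        fun t ht => ?_
      have h1 := hgrow t ht (hcon t ht).le
      have hta : t ∈ Ici a := (hT t ht).2
      have h2 := h.hubble_pos hta
      have h3 := h.le_hubble t hta
      have h4 : -(n * H t ^ 2) ≤ H' t := by
        have h5 : 0 ≤ ((n : ℝ) - 1) * (H' t + n * H t ^ 2) := by linarith [h.pos t hta]
        linarith [nonneg_of_mul_nonneg_right h5 (by linarith)]
      have h6 : -(n * H t) ≤ H' t / H t := by
        rw [le_div_iff₀ h2]
        linarith
      have h7 : 1 / (2 * (n : ℝ) ^ 2) * -(n * H t) ≤ 1 / (2 * (n : ℝ) ^ 2) * (H' t / H t) :=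
        mul_le_mul_of_nonneg_left h6 (by positivity)
      have h8 : 1 / (2 * (n : ℝ) ^ 2) * -(n * H t) = -(H t / (2 * n)) := by
        field_simp
      linarith
    have hHpos : Tendsto H atTop (𝓝[>] 0) := tendsto_nhdsWithin_iff.2 ⟨hH, by
      filter_upwards [eventually_ge_atTop a] with t ht using h.hubble_pos ht⟩
    have hlog : Tendsto (fun t => 1 / (2 * (n : ℝ) ^ 2) * Real.log (H t)) atTop atBot :=
      (Real.tendsto_log_nhdsGT_zero.comp hHpos).const_mul_atBot (by positivity)
    obtain ⟨t, ht, htT⟩ := ((hlog.eventually_lt_atBot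
      (g T + 1 / (2 * n ^ 2) * Real.log (H T) - κ)).and (eventually_ge_atTop T)).exists
    have h1 : g T + 1 / (2 * n ^ 2) * Real.log (H T) ≤ g t + 1 / (2 * n ^ 2) * Real.log (H t) :=
      hmono self_mem_Ici htT htT
    linarith [hcon t htT]
  obtain ⟨T₁, hT₁, hκT⟩ := hreach
  filter_upwards [eventually_ge_atTop T₁] with t ht
  have hta : t ∈ Ici a := haT.trans (hT₁.out.trans ht)
  have hbarrier : κ ≤ g t := by
    have haT₁ : a ≤ T₁ := haT.trans hT₁
    -- At any time with g = κ the derivative of g is positive, so g cannot fall below κ again. The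
    -- comparison lemma bounds from above, hence the sign change.
    refine neg_le_neg_iff.1 (image_le_of_deriv_right_lt_deriv_boundary (f := fun s => -g s)
      (f' := fun s => -(w s * ψ s / v s - 2 * (H' s / H s))) (B := fun _ => -κ) (B' := fun _ => 0)
      (a := T₁) (b := t) (fun s hs => ?_) (fun s hs => ?_) (neg_le_neg hκT)
      (fun s => hasDerivAt_const s _) (fun s hs heq => ?_) ⟨ht, le_rfl⟩)
    · exact (hgd s (haT₁.trans hs.1)).neg.continuousWithinAt.mono fun x hx => haT₁.trans hx.1
    · exact ((hgd s (haT₁.trans hs.1)).neg).mono fun x hx => (haT₁.trans hs.1).trans hx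
    · have h1 := hgrow s (hT₁.out.trans hs.1) (neg_inj.1 heq).le
      have h2 := h.hubble_pos (haT₁.trans hs.1 : s ∈ Ici a)
      have h3 : 0 < H s / (2 * n) := by positivity
      linarith
  have h1 := (hgκ t hta).2.1 hbarrier
  have h2 := h.le_hubble t hta
  have h3 : (1 - 3 / (4 * (n : ℝ))) * (n * (n - 1)) * H t ^ 2 =
      n * (n - 1) * H t ^ 2 - 3 / 4 * ((n - 1) * H t ^ 2) := by
    field_simp
  have h4 : 0 ≤ ((n : ℝ) - 1) * (H' t + 3 / 4 * H t ^ 2) := by linarith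
  linarith [nonneg_of_mul_nonneg_right h4 (by linarith)]

end ReducedDynamics

end Asymptotics

/-! ### Deceleration parameter and steepness along the solution -/

section Acceleration

variable {E : Type*} [NormedAddCommGroup E] [NormedSpace ℝ E]

theorem deceleration_neg {γ : ℝ → E →L[ℝ] E →L[ℝ] ℝ} {s : Set ℝ} {t H' : ℝ}
    (hs : UniqueDiffWithinAt ℝ s t) (hd : HasDerivWithinAt (hubble s γ) H' s t)
    (hpos : 0 < hubble s γ t) (hH' : -(3 / 4) * hubble s γ t ^ 2 ≤ H') :
    deceleration s γ t < 0 := by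
  have h1 : -(3 / 4) ≤ H' / hubble s γ t ^ 2 := by rwa [le_div_iff₀ (by positivity)]
  rw [deceleration, hd.derivWithin hs]
  linarith

theorem eventually_abs_deriv_le {J : Set ℝ} {V φ : ℝ → ℝ} {a β : ℝ} {l : Filter ℝ}
    (hV : ∀ x ∈ J, 0 < V x) (hφ : MapsTo φ (Ici a) J) (hl : Tendsto φ atTop l)
    (h : steepness J V l < (β : EReal)) :
    ∀ᶠ t in atTop, |derivWithin V J (φ t)| ≤ β * V (φ t) := by
  have hJ : ∀ᶠ t in atTop, φ t ∈ J := by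
    filter_upwards [eventually_ge_atTop a] with t ht using hφ ht
  have h1 := (tendsto_inf.2 ⟨hl, tendsto_principal.2 hJ⟩).eventually (eventually_lt_of_limsup_lt h)
  filter_upwards [h1, hJ] with t ht htJ
  exact ((div_lt_iff₀ (hV _ htJ)).1 (EReal.coe_lt_coe_iff.1 ht)).le

end Acceleration

end CoupledQuintessence

/-! ### Proof of the theorem -/

theorem mainTheorem4
    {E : Type*} [NormedAddCommGroup E] [NormedSpace ℝ E] [FiniteDimensional ℝ E]
    {G : Type*} [TopologicalSpace G] [ChartedSpace E G] [Group G] [LieGroup 𝓘(ℝ, E) ∞ G]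
    (n : ℕ) (hn : 3 ≤ n) (hE : Module.finrank ℝ E = n)
    (hG : ∀ h : E →L[ℝ] E →L[ℝ] ℝ, IsRiemannian h → groupScalarCurvature E G h ≤ 0)
    (J : Set ℝ) (hJ : J.OrdConnected) (hJ' : (interior J).Nonempty)
    (C c V : ℝ → ℝ) (hC : AdmissibleCoupling J C c) (hV : AdmissiblePotential J V)
    (t₀ : ℝ) (γ : ℝ → E →L[ℝ] E →L[ℝ] ℝ) (φ ρ : ℝ → ℝ) (j : ℝ → E →L[ℝ] ℝ)
    (S : ℝ → E →L[ℝ] E →L[ℝ] ℝ)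
    (hsol : IsESMSolution (groupBracket E G) (Set.Ici t₀) J C c V γ φ ρ j S)
    (henergy : EnergyConditions (Set.Ici t₀) γ ρ j S)
    (hexp : 0 < hubble (Set.Ici t₀) γ t₀)
    (hV₀ : sInf ((V ∘ φ) '' Set.Ici t₀) = 0) :
    (Tendsto φ atTop atTop ∧
      (steepness J V atTop < ((2 / √((n : ℝ) * ((n : ℝ) - 1)) : ℝ) : EReal) →
        EventuallyAccelerating (Set.Ici t₀) γ)) ∨
    (Tendsto φ atTop atBot ∧
      (steepness J V atBot < ((2 / √((n : ℝ) * ((n : ℝ) - 1)) : ℝ) : EReal) →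
        EventuallyAccelerating (Set.Ici t₀) γ)) := by
  have hs : UniqueDiffOn ℝ (Ici t₀) := uniqueDiffOn_Ici t₀
  have hn2 : 2 ≤ n := by omega
  obtain ⟨C₀, hC₀⟩ := hC.bound
  have hineq := fun (t : ℝ) (ht : t ∈ Ici t₀) =>
    hsol.hubble_inequalities hs henergy hC.nonneg hC₀ hn2 hE ht (hG _ (hsol.isRiemannian t ht))
  choose! H' hH' henergy' hle hge hfield using hineq
  have hφ : ∀ t ∈ Ici t₀, HasDerivWithinAt φ (derivWithin φ (Ici t₀) t) (Ici t₀) t := fun t ht =>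
    (hsol.contDiffOn_field.differentiableOn (by norm_num) t ht).hasDerivWithinAt
  have hred : ReducedDynamics n t₀ (|C₀| * (n + 1)) (hubble (Ici t₀) γ) H'
      (derivWithin φ (Ici t₀)) (derivWithin (derivWithin φ (Ici t₀)) (Ici t₀)) (V ∘ φ)
      (fun t => derivWithin V J (φ t)) :=
    { hubble := hH'
      velocity := fun t ht => (((hsol.contDiffOn_field.derivWithin hs (m := 1)
        (by norm_num)).differentiableOn (by norm_num)) t ht).hasDerivWithinAt
      potential := fun t ht => (hV.contDiffOn.differentiableOn (by norm_num) _
        (hsol.mapsTo_field ht)).hasDerivWithinAt.comp t (hφ t ht) hsol.mapsTo_field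
      pos := fun t ht => hV.pos _ (hsol.mapsTo_field ht)
      energy := henergy'
      hubble_le := hle
      le_hubble := hge
      field := hfield
      initial := hexp }
  -- V is bounded along the solution by the initial value of n(n-1)H², as H is non-increasing; the
  -- assumption on V' then bounds V' there.
  obtain ⟨W, hW⟩ : ∃ W, ∀ t ∈ Ici t₀, |derivWithin V J (φ t)| ≤ W := by
    have hbdd : Bornology.IsBounded (V '' (φ '' Ici t₀)) := by
      refine isBounded_iff_forall_norm_le.2
        ⟨n * (n - 1) * hubble (Ici t₀) γ t₀ ^ 2, ?_⟩
      rintro _ ⟨_, ⟨t, ht, rfl⟩, rfl⟩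
      rw [Real.norm_eq_abs, abs_of_pos (hV.pos _ (hsol.mapsTo_field ht))]
      have h1 := hred.energy t ht
      have h2 := hred.hubble_sq_le hn2 ht
      have h3 := hred.pos t ht
      simp only [Function.comp_apply] at h1 h3
      linarith [sq_nonneg (derivWithin φ (Ici t₀) t)]
    obtain ⟨W, hW⟩ := isBounded_iff_forall_norm_le.1
      (hV.deriv_bounded _ hsol.mapsTo_field.image_subset hbdd)
    exact ⟨W, fun t ht => hW _ (mem_image_of_mem _ (mem_image_of_mem φ ht))⟩
  have hH0 := hred.tendsto_hubble hn2 (by positivity) hW hV₀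
  -- The acceleration argument sees the end of J only through the filter, so both signs of φ are
  -- treated at once.
  have hacc : ∀ l, Tendsto φ atTop l →
      steepness J V l < ((2 / √((n : ℝ) * ((n : ℝ) - 1)) : ℝ) : EReal) →
      EventuallyAccelerating (Ici t₀) γ := by
    intro l hl hsteep
    filter_upwards [hred.eventually_accelerating hn2 hH0
      (eventually_abs_deriv_le hV.pos hsol.mapsTo_field hl hsteep), eventually_ge_atTop t₀]
      with t ht ht₀
    exact ⟨hred.hubble_pos ht₀, deceleration_neg (hs t ht₀) (hH' t ht₀) (hred.hubble_pos ht₀) ht⟩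
  exact (hV.tendsto_field (fun t ht => (hφ t ht).continuousWithinAt) hsol.mapsTo_field
    (hred.tendsto_potential hH0)).imp (fun h => ⟨h, hacc _ h⟩) (fun h => ⟨h, hacc _ h⟩)
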